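/- A *cartesian bicategory* is a symmetric monoidal category $(\mathcal B,\otimes,I)$ enriched over posets (composition and $\otimes$ are monotone) in which every object $X$ carries a cocommutative comonoid $\Delta_X\colon X\to X\otimes X$, $\varepsilon_X\colon X\to I$ such that: $\Delta_X$ and $\varepsilon_X$ have right adjoints $\nabla_X$ and $\eta_X$; the Frobenius law $(\Delta_X\otimes \mathrm{id})\,;(\mathrm{id}\otimes\nabla_X)=\nabla_X;\Delta_X=(\mathrm{id}\otimes\Delta_X)\,;(\nabla_X\otimes \mathrm{id})$ holds (associators omitted); every $R\colon X\to Y$ satisfies $R;\Delta_Y\le\Delta_X;(R\otimes R)$ and $R;\varepsilon_Y\le\varepsilon_X$; and the comonoids are compatible with $\otimes$ and $I$ (the comonoid on $X\otimes Y$ is the tensor product of those on $X$ and $Y$, and the one on $I$ is trivial). A morphism of cartesian bicategories is a (strong symmetric) monoidal functor that preserves the order, the comonoids and their adjoint monoids; an isomorphism is an invertible morphism. A morphism $R\colon X\to Y$ is *total* if $\varepsilon_X\le R;\varepsilon_Y$ and *single valued* if $\Delta_X;(R\otimes R)\le R;\Delta_Y$; a *map* is a single valued, total morphism. The maps form a category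 $\mathrm{Map}(\mathcal B)$ with the objects of $\mathcal B$, in which $\otimes$ is a binary product and $I$ is terminal. The *opposite* $R^{\mathrm{op}}\colon Y\to X$ of $R\colon X\to Y$ is obtained by bending its wires with the cup $\eta_X;\Delta_X$ and the cap $\nabla_Y;\varepsilon_Y$. $\mathcal B$ *has enough maps* if every $R\colon X\to I$ is of the form $f^{\mathrm{op}};\varepsilon_Z$ for some map $f\colon Z\to X$. $\mathcal B$ *satisfies the axiom of choice* if for every total $R\colon X\to Y$ there is a map $f\colon X\to Y$ with $f\le R$. For a category $\mathcal C$ with finite products and weak pullbacks, $\mathsf{Span}^{\sim}(\mathcal C)$ is the cartesian bicategory with the objects of $\mathcal C$, whose morphisms $X\to Y$ are spans $X\leftarrow A\to Y$ modulo $\sim$, where $S\le T$ if there is a morphism of spans $S\Rightarrow T$ (a morphism between the apexes commuting with the legs) and $S\sim T$ if $S\le T$ and $T\le S$. It is ordered by $\le$, composition is by weak pullback, and the monoidal product is the product of $\mathcal C$; $\Delta_X$ and $\varepsilon_X$ are the spans $X\xleftarrow{\mathrm{id}}X\to X\times X$ (the diagonal) and $X\xleftarrow{\mathrm{id}}X\to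 1$, and their right adjoints are the reversed spans. **Theorem.** Let $\mathcal B$ be a cartesian bicategory with enough maps. Then $\mathcal B$ satisfies the axiom of choice if and only if $\mathrm{Map}(\mathcal B)$ has weak pullbacks and $\mathcal B\cong\mathsf{Span}^{\sim}(\mathrm{Map}(\mathcal B))$ as cartesian bicategories. -/

import Mathlib

universe v u v₁ u₁ v₂ u₂

open CategoryTheory

namespace CartBicat

open MonoidalCategory Limits
open scoped ComonObj

/-- A cartesian bicategory: a symmetric monoidal category enriched over posets in which every object
carries a cocommutative comonoid `Δ`, `ε` compatible with the monoidal structure (these are the data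
and axioms of `CopyDiscardCategory`), such that `Δ` and `ε` have right adjoints `cocopy` and
`codiscard`, the Frobenius law holds, and every morphism is a lax comonoid homomorphism. -/
class CartesianBicategory (B : Type u) [Category.{v} B] [MonoidalCategory B]
    extends CopyDiscardCategory B where
  homOrder (X Y : B) : PartialOrder (X ⟶ Y)
  comp_mono {X Y Z : B} {R R' : X ⟶ Y} {S S' : Y ⟶ Z} :
    R ≤ R' → S ≤ S' → R ≫ S ≤ R' ≫ S'
  tensor_mono {X Y Z W : B} {R R' : X ⟶ Y} {S S' : Z ⟶ W} :
    R ≤ R' → S ≤ S' → R ⊗ₘ S ≤ R' ⊗ₘ S'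
  cocopy (X : B) : X ⊗ X ⟶ X
  codiscard (X : B) : 𝟙_ B ⟶ X
  copy_unit_le (X : B) : 𝟙 X ≤ Δ[X] ≫ cocopy X
  copy_counit_le (X : B) : cocopy X ≫ Δ[X] ≤ 𝟙 (X ⊗ X)
  discard_unit_le (X : B) : 𝟙 X ≤ ε[X] ≫ codiscard X
  discard_counit_le (X : B) : codiscard X ≫ ε[X] ≤ 𝟙 (𝟙_ B)
  frobenius_left (X : B) : Δ[X] ▷ X ≫ (α_ X X X).hom ≫ X ◁ cocopy X = cocopy X ≫ Δ[X]
  frobenius_right (X : B) : X ◁ Δ[X] ≫ (α_ X X X).inv ≫ cocopy X ▷ X = cocopy X ≫ Δ[X]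
  lax_copy {X Y : B} (R : X ⟶ Y) : R ≫ Δ[Y] ≤ Δ[X] ≫ (R ⊗ₘ R)
  lax_discard {X Y : B} (R : X ⟶ Y) : R ≫ ε[Y] ≤ ε[X]

attribute [reducible, instance] CartesianBicategory.homOrder

open CartesianBicategory

section Maps

variable {B : Type u} [Category.{v} B] [MonoidalCategory B] [CartesianBicategory B]

/-- `R` is single valued. -/
def IsSingleValued {X Y : B} (R : X ⟶ Y) : Prop := Δ[X] ≫ (R ⊗ₘ R) ≤ R ≫ Δ[Y]

/-- `R` is total. -/
def IsTotal {X Y : B} (R : X ⟶ Y) : Prop := ε[X] ≤ R ≫ ε[Y]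

/-- A map is a single valued and total morphism. -/
def IsMap {X Y : B} (f : X ⟶ Y) : Prop := IsSingleValued f ∧ IsTotal f

/-- The opposite of a morphism, obtained by bending both of its wires. -/
def opposite {X Y : B} (R : X ⟶ Y) : Y ⟶ X :=
  (ρ_ Y).inv ≫ Y ◁ (codiscard X ≫ Δ[X]) ≫ Y ◁ (R ▷ X) ≫ (α_ Y Y X).inv ≫
    (cocopy Y ≫ ε[Y]) ▷ X ≫ (λ_ X).hom

variable (B) in
/-- The axiom of choice: every total morphism contains a map. -/
def HasChoice : Prop :=
  ∀ ⦃X Y : B⦄ (R : X ⟶ Y), IsTotal R → ∃ f : X ⟶ Y, IsMap f ∧ f ≤ R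

variable (B) in
/-- Having enough maps: every `R : X ⟶ I` is of the form `fᵒᵖ ; ε` for some map `f : Z ⟶ X`. -/
def HasEnoughMaps : Prop :=
  ∀ ⦃X : B⦄ (R : X ⟶ 𝟙_ B), ∃ (Z : B) (f : Z ⟶ X), IsMap f ∧ R = opposite f ≫ ε[Z]

lemma isMap_iff {X Y : B} (f : X ⟶ Y) :
    IsMap f ↔ f ≫ Δ[Y] = Δ[X] ≫ (f ⊗ₘ f) ∧ f ≫ ε[Y] = ε[X] := by
  constructor
  · rintro ⟨h₁, h₂⟩
    exact ⟨le_antisymm (lax_copy f) h₁, le_antisymm (lax_discard f) h₂⟩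
  · rintro ⟨h₁, h₂⟩
    exact ⟨h₁.ge, h₂.ge⟩

lemma IsMap.of_adjoint {X Y : B} (f : X ⟶ Y) (g : Y ⟶ X) (h₁ : 𝟙 X ≤ f ≫ g)
    (h₂ : g ≫ f ≤ 𝟙 Y) : IsMap f := by
  constructor
  · calc Δ[X] ≫ (f ⊗ₘ f) = 𝟙 X ≫ Δ[X] ≫ (f ⊗ₘ f) := by simp
      _ ≤ (f ≫ g) ≫ Δ[X] ≫ (f ⊗ₘ f) := comp_mono h₁ le_rfl
      _ = f ≫ (g ≫ Δ[X]) ≫ (f ⊗ₘ f) := by simp only [Category.assoc]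
      _ ≤ f ≫ (Δ[Y] ≫ (g ⊗ₘ g)) ≫ (f ⊗ₘ f) :=
        comp_mono le_rfl (comp_mono (lax_copy g) le_rfl)
      _ = (f ≫ Δ[Y]) ≫ ((g ≫ f) ⊗ₘ (g ≫ f)) := by
        simp only [Category.assoc, tensorHom_comp_tensorHom]
      _ ≤ (f ≫ Δ[Y]) ≫ (𝟙 Y ⊗ₘ 𝟙 Y) := comp_mono le_rfl (tensor_mono h₂ h₂)
      _ = f ≫ Δ[Y] := by simp
  · calc ε[X] = 𝟙 X ≫ ε[X] := by simp
      _ ≤ (f ≫ g) ≫ ε[X] := comp_mono h₁ le_rfl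
      _ = f ≫ g ≫ ε[X] := by simp only [Category.assoc]
      _ ≤ f ≫ ε[Y] := comp_mono le_rfl (lax_discard g)

lemma IsMap.of_iso {X Y : B} (e : X ≅ Y) : IsMap e.hom :=
  IsMap.of_adjoint e.hom e.inv (by simp) (by simp)

lemma IsMap.id (X : B) : IsMap (𝟙 X) := IsMap.of_iso (Iso.refl X)

lemma IsMap.comp {X Y Z : B} {f : X ⟶ Y} {g : Y ⟶ Z} (hf : IsMap f) (hg : IsMap g) :
    IsMap (f ≫ g) := by
  rw [isMap_iff] at hf hg ⊢
  constructor
  · rw [Category.assoc, hg.1, reassoc_of% hf.1, tensorHom_comp_tensorHom]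
  · rw [Category.assoc, hg.2, hf.2]

lemma IsMap.tensor {X Y Z W : B} {f : X ⟶ Y} {g : Z ⟶ W} (hf : IsMap f) (hg : IsMap g) :
    IsMap (f ⊗ₘ g) := by
  rw [isMap_iff] at hf hg ⊢
  constructor
  · rw [CopyDiscardCategory.copy_tensor, CopyDiscardCategory.copy_tensor,
      tensorHom_comp_tensorHom_assoc, hf.1, hg.1, Category.assoc, ← tensorμ_natural,
      tensorHom_comp_tensorHom_assoc]
  · rw [CopyDiscardCategory.discard_tensor, CopyDiscardCategory.discard_tensor,
      tensorHom_comp_tensorHom_assoc, hf.2, hg.2]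

variable (B) in
/-- The property of being a map. -/
def mapProperty : MorphismProperty B := fun _ _ f => IsMap f

instance : (mapProperty B).IsMultiplicative where
  id_mem X := IsMap.id X
  comp_mem _ _ hf hg := IsMap.comp hf hg

instance : (mapProperty B).IsMonoidal where
  whiskerLeft X _ _ g hg := by
    rw [← id_tensorHom]; exact IsMap.tensor (IsMap.id X) hg
  whiskerRight f hf Y := by
    rw [← tensorHom_id]; exact IsMap.tensor hf (IsMap.id Y)

instance : (mapProperty B).IsStableUnderBraiding where
  associator_hom_mem _ _ _ := IsMap.of_iso (α_ _ _ _)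
  associator_inv_mem _ _ _ := IsMap.of_iso (α_ _ _ _).symm
  leftUnitor_hom_mem _ := IsMap.of_iso (λ_ _)
  leftUnitor_inv_mem _ := IsMap.of_iso (λ_ _).symm
  rightUnitor_hom_mem _ := IsMap.of_iso (ρ_ _)
  rightUnitor_inv_mem _ := IsMap.of_iso (ρ_ _).symm
  braiding_hom_mem _ _ := IsMap.of_iso (β_ _ _)
  braiding_inv_mem _ _ := IsMap.of_iso (β_ _ _).symm

variable (B) in
/-- The category `Map(B)`: the objects of `B`, with the maps of `B` as morphisms. It carries the
monoidal structure and the symmetry inherited from `B`. -/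
abbrev Maps := WideSubcategory (mapProperty B)

lemma isMap_copy (X : B) : IsMap Δ[X] :=
  IsMap.of_adjoint _ (cocopy X) (copy_unit_le X) (copy_counit_le X)

lemma isMap_discard (X : B) : IsMap ε[X] :=
  IsMap.of_adjoint _ (codiscard X) (discard_unit_le X) (discard_counit_le X)

lemma copy_proj (X Y : B) :
    (CopyDiscardCategory.comonObj (X ⊗ Y)).comul ≫ ((X ◁ ε[Y] ≫ (ρ_ X).hom) ⊗ₘ (ε[X] ▷ Y ≫ (λ_ Y).hom)) = 𝟙 (X ⊗ Y) := by
  have h : tensorμ X (𝟙_ B) (𝟙_ B) Y ≫ ((ρ_ X).hom ⊗ₘ (λ_ Y).hom) =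
      (ρ_ X).hom ⊗ₘ (λ_ Y).hom := by
    simp only [tensorμ, braiding_tensorUnit_left]
    monoidal
  rw [CopyDiscardCategory.copy_tensor, Category.assoc, ← tensorHom_comp_tensorHom,
    ← id_tensorHom, ← tensorHom_id, ← tensorμ_natural_assoc, h, tensorHom_comp_tensorHom,
    tensorHom_comp_tensorHom, id_tensorHom, tensorHom_id]
  simp

lemma copy_tensor_proj_left {T X Y : B} (f : T ⟶ X) {g : T ⟶ Y} (hg : IsMap g) :
    (Δ[T] ≫ (f ⊗ₘ g)) ≫ X ◁ ε[Y] ≫ (ρ_ X).hom = f := by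
  rw [MonoidalCategory.tensorHom_def, Category.assoc, Category.assoc, ← whiskerLeft_comp_assoc,
    ((isMap_iff g).1 hg).2, ← whisker_exchange_assoc, ComonObj.comul_counit_assoc]
  simp

lemma copy_tensor_proj_right {T X Y : B} {f : T ⟶ X} (g : T ⟶ Y) (hf : IsMap f) :
    (Δ[T] ≫ (f ⊗ₘ g)) ≫ ε[X] ▷ Y ≫ (λ_ Y).hom = g := by
  rw [MonoidalCategory.tensorHom_def', Category.assoc, Category.assoc, ← comp_whiskerRight_assoc,
    ((isMap_iff f).1 hf).2, whisker_exchange_assoc, ComonObj.counit_comul_assoc]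
  simp

lemma eq_copy_tensor_proj {T X Y : B} {m : T ⟶ X ⊗ Y} (hm : IsMap m) :
    m = Δ[T] ≫ ((m ≫ X ◁ ε[Y] ≫ (ρ_ X).hom) ⊗ₘ (m ≫ ε[X] ▷ Y ≫ (λ_ Y).hom)) := by
  rw [← tensorHom_comp_tensorHom, ← reassoc_of% ((isMap_iff m).1 hm).1]
  exact (Category.comp_id _).symm.trans (congrArg (m ≫ ·) (copy_proj X Y).symm)

/-- The tensor product and the unit of `B` are binary products and a terminal object of `Map(B)`. -/
instance : CartesianMonoidalCategory (Maps B) where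
  isTerminalTensorUnit := IsTerminal.ofUniqueHom (fun X => ⟨ε[X.obj], isMap_discard _⟩) (by
    intro X f
    ext
    have h := ((isMap_iff f.hom).1 f.property).2
    erw [CopyDiscardCategory.discard_unit, Category.comp_id] at h
    exact h)
  fst X Y := ⟨X.obj ◁ ε[Y.obj] ≫ (ρ_ X.obj).hom,
    ((mapProperty B).whiskerLeft_mem X.obj _ (isMap_discard Y.obj)).comp (IsMap.of_iso (ρ_ _))⟩
  snd X Y := ⟨ε[X.obj] ▷ Y.obj ≫ (λ_ Y.obj).hom,
    ((mapProperty B).whiskerRight_mem _ (isMap_discard X.obj) Y.obj).comp (IsMap.of_iso (λ_ _))⟩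
  fst_def X Y := by ext; rfl
  snd_def X Y := by ext; rfl
  tensorProductIsBinaryProduct X Y := BinaryFan.IsLimit.mk _
    (fun {T} f g => ⟨Δ[T.obj] ≫ (f.hom ⊗ₘ g.hom), (isMap_copy _).comp (f.property.tensor g.property)⟩)
    (fun f g => WideSubcategory.hom_ext _ (copy_tensor_proj_left f.hom g.property))
    (fun f g => WideSubcategory.hom_ext _ (copy_tensor_proj_right g.hom f.property))
    (by
      rintro T f g m rfl rfl
      exact WideSubcategory.hom_ext _ (eq_copy_tensor_proj m.property))

end Maps

end CartBicat

namespace CartBicat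

open MonoidalCategory Limits CartesianMonoidalCategory CartesianBicategory
open scoped ComonObj

section Spans

variable {C : Type u} [Category.{v} C]

/-- Spans from `X` to `Y`, with no condition on the legs. -/
abbrev Spans (X Y : C) := Span (⊤ : MorphismProperty C) (⊤ : MorphismProperty C) X Y

namespace Spans

/-- The span `X ← A → Y` with the given legs. -/
def of {X Y A : C} (l : A ⟶ X) (r : A ⟶ Y) : Spans X Y := ⟨A, l, r, trivial, trivial⟩

/-- The preorder on spans: `S` is below `T` if there is a morphism of spans `S ⇒ T`. -/
def Le {X Y : C} (S T : Spans X Y) : Prop := Nonempty (S ⟶ T)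

lemma Le.refl {X Y : C} (S : Spans X Y) : S.Le S := ⟨𝟙 S⟩

lemma Le.trans {X Y : C} {S T U : Spans X Y} (h : S.Le T) (h' : T.Le U) : S.Le U :=
  ⟨h.some ≫ h'.some⟩

/-- The equivalence `∼` on spans: there are morphisms of spans in both directions. -/
def setoid (X Y : C) : Setoid (Spans X Y) where
  r S T := S.Le T ∧ T.Le S
  iseqv := ⟨fun S => ⟨.refl S, .refl S⟩, fun h => ⟨h.2, h.1⟩,
    fun h h' => ⟨h.1.trans h'.1, h'.2.trans h.2⟩⟩

/-- The composite of two spans, given by a weak pullback of the two inner legs. -/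
noncomputable def comp [HasWeakPullbacks C] {X Y Z : C} (S : Spans X Y) (T : Spans Y Z) :
    Spans X Z :=
  of (weakPullback.fst S.r T.l ≫ S.l) (weakPullback.snd S.r T.l ≫ T.r)

/-- The product of two spans. -/
def tensor [CartesianMonoidalCategory C] {X Y Z W : C} (S : Spans X Y) (T : Spans Z W) :
    Spans (X ⊗ Z) (Y ⊗ W) :=
  of (S.l ⊗ₘ T.l) (S.r ⊗ₘ T.r)

/-- The pairs of generalised elements related by a span. -/
def Rel {X Y T : C} (S : Spans X Y) (x : T ⟶ X) (y : T ⟶ Y) : Prop :=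
  ∃ a : T ⟶ S.apex, a ≫ S.l = x ∧ a ≫ S.r = y

lemma le_iff {X Y : C} (S T : Spans X Y) :
    S.Le T ↔ ∀ {A : C} (x : A ⟶ X) (y : A ⟶ Y), S.Rel x y → T.Rel x y := by
  constructor
  · rintro ⟨h⟩ A _ _ ⟨a, rfl, rfl⟩
    exact ⟨a ≫ h.hom, by simp, by simp⟩
  · intro h
    obtain ⟨a, h₁, h₂⟩ := h S.l S.r ⟨𝟙 _, by simp, by simp⟩
    exact ⟨⟨a, h₁, h₂⟩⟩

lemma rel_of {X Y A T : C} (l : A ⟶ X) (r : A ⟶ Y) (x : T ⟶ X) (y : T ⟶ Y) :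
    (of l r).Rel x y ↔ ∃ a : T ⟶ A, a ≫ l = x ∧ a ≫ r = y := Iff.rfl

lemma rel_comp [HasWeakPullbacks C] {X Y Z A : C} (S : Spans X Y) (T : Spans Y Z)
    (x : A ⟶ X) (z : A ⟶ Z) :
    (S.comp T).Rel x z ↔ ∃ y : A ⟶ Y, S.Rel x y ∧ T.Rel y z := by
  constructor
  · rintro ⟨a, rfl, rfl⟩
    refine ⟨a ≫ weakPullback.fst S.r T.l ≫ S.r, ⟨a ≫ weakPullback.fst S.r T.l, ?_, ?_⟩,
      ⟨a ≫ weakPullback.snd S.r T.l, ?_, ?_⟩⟩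
    · exact Category.assoc _ _ _
    · exact Category.assoc _ _ _
    · exact (Category.assoc _ _ _).trans (congrArg (a ≫ ·) weakPullback.condition.symm)
    · exact Category.assoc _ _ _
  · rintro ⟨_, ⟨a, rfl, rfl⟩, ⟨b, h, rfl⟩⟩
    refine ⟨weakPullback.lift a b h.symm, ?_, ?_⟩
    · exact weakPullback.lift_fst_assoc _ _ _ _
    · exact weakPullback.lift_snd_assoc _ _ _ _

lemma rel_tensor [CartesianMonoidalCategory C] {X Y Z W A : C} (S : Spans X Y) (T : Spans Z W)
    (x : A ⟶ X ⊗ Z) (y : A ⟶ Y ⊗ W) :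
    (S.tensor T).Rel x y ↔ S.Rel (x ≫ fst _ _) (y ≫ fst _ _) ∧
      T.Rel (x ≫ snd _ _) (y ≫ snd _ _) := by
  constructor
  · rintro ⟨a, rfl, rfl⟩
    change A ⟶ S.apex ⊗ T.apex at a
    refine ⟨⟨a ≫ fst _ _, ?_, ?_⟩, ⟨a ≫ snd _ _, ?_, ?_⟩⟩ <;>
      simp only [tensor, of, Category.assoc, tensorHom_fst, tensorHom_snd]
  · rintro ⟨⟨a, h₁, h₂⟩, ⟨b, h₃, h₄⟩⟩
    refine ⟨lift a b, ?_, ?_⟩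
    · simp only [tensor, of, lift_map, h₁, h₃, lift_comp_fst_snd]
    · simp only [tensor, of, lift_map, h₂, h₄, lift_comp_fst_snd]

end Spans

/-- `∼`-equivalence classes of spans from `X` to `Y`. -/
def SpanClass (X Y : C) := Quotient (Spans.setoid X Y)

namespace SpanClass

/-- The class of a span. -/
def mk {X Y : C} (S : Spans X Y) : SpanClass X Y := Quotient.mk (Spans.setoid X Y) S

/-- The order on classes of spans. -/
def Le {X Y : C} (S T : SpanClass X Y) : Prop :=
  Quotient.liftOn₂ S T Spans.Le fun _ _ _ _ h h' => propext
    ⟨fun k => (h.2.trans k).trans h'.1, fun k => (h.1.trans k).trans h'.2⟩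

instance (X Y : C) : PartialOrder (SpanClass X Y) where
  le := Le
  le_refl S := by
    induction S using Quotient.ind
    exact Spans.Le.refl _
  le_trans S T U := by
    induction S using Quotient.ind
    induction T using Quotient.ind
    induction U using Quotient.ind
    exact Spans.Le.trans
  le_antisymm S T := by
    induction S using Quotient.ind
    induction T using Quotient.ind
    exact fun h h' => Quotient.sound ⟨h, h'⟩

/-- The pairs of generalised elements related by a class of spans. -/
def Rel {X Y T : C} (S : SpanClass X Y) (x : T ⟶ X) (y : T ⟶ Y) : Prop :=
  Quotient.liftOn S (fun S => S.Rel x y) fun S T h => propext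
    ⟨(Spans.le_iff S T).1 h.1 x y, (Spans.le_iff T S).1 h.2 x y⟩

lemma le_iff {X Y : C} {S T : SpanClass X Y} :
    S ≤ T ↔ ∀ {A : C} (x : A ⟶ X) (y : A ⟶ Y), S.Rel x y → T.Rel x y := by
  induction S using Quotient.ind
  induction T using Quotient.ind
  exact Spans.le_iff _ _

lemma ext_rel {X Y : C} {S T : SpanClass X Y}
    (h : ∀ {A : C} (x : A ⟶ X) (y : A ⟶ Y), S.Rel x y ↔ T.Rel x y) : S = T :=
  le_antisymm (le_iff.2 fun x y => (h x y).1) (le_iff.2 fun x y => (h x y).2)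

/-- Composition of classes of spans. -/
noncomputable def comp [HasWeakPullbacks C] {X Y Z : C} (S : SpanClass X Y)
    (T : SpanClass Y Z) : SpanClass X Z :=
  Quotient.liftOn₂ S T (fun S T => mk (S.comp T)) fun S T S' T' h h' => ext_rel fun x z =>
    (Spans.rel_comp S T x z).trans <| Iff.trans
      ⟨fun ⟨y, a, b⟩ => ⟨y, (Spans.le_iff _ _).1 h.1 _ _ a, (Spans.le_iff _ _).1 h'.1 _ _ b⟩,
        fun ⟨y, a, b⟩ => ⟨y, (Spans.le_iff _ _).1 h.2 _ _ a, (Spans.le_iff _ _).1 h'.2 _ _ b⟩⟩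
      (Spans.rel_comp S' T' x z).symm

/-- The product of classes of spans. -/
def tensor [CartesianMonoidalCategory C] {X Y Z W : C} (S : SpanClass X Y) (T : SpanClass Z W) :
    SpanClass (X ⊗ Z) (Y ⊗ W) :=
  Quotient.liftOn₂ S T (fun S T => mk (S.tensor T)) fun S T S' T' h h' => ext_rel fun x z =>
    (Spans.rel_tensor S T x z).trans <| Iff.trans
      ⟨fun ⟨a, b⟩ => ⟨(Spans.le_iff _ _).1 h.1 _ _ a, (Spans.le_iff _ _).1 h'.1 _ _ b⟩,
        fun ⟨a, b⟩ => ⟨(Spans.le_iff _ _).1 h.2 _ _ a, (Spans.le_iff _ _).1 h'.2 _ _ b⟩⟩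
      (Spans.rel_tensor S' T' x z).symm

lemma rel_comp [HasWeakPullbacks C] {X Y Z A : C} (S : SpanClass X Y) (T : SpanClass Y Z)
    (x : A ⟶ X) (z : A ⟶ Z) :
    (S.comp T).Rel x z ↔ ∃ y : A ⟶ Y, S.Rel x y ∧ T.Rel y z := by
  induction S using Quotient.ind
  induction T using Quotient.ind
  exact Spans.rel_comp _ _ _ _

lemma rel_tensor [CartesianMonoidalCategory C] {X Y Z W A : C} (S : SpanClass X Y)
    (T : SpanClass Z W) (x : A ⟶ X ⊗ Z) (y : A ⟶ Y ⊗ W) :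
    (S.tensor T).Rel x y ↔ S.Rel (x ≫ fst _ _) (y ≫ fst _ _) ∧
      T.Rel (x ≫ snd _ _) (y ≫ snd _ _) := by
  induction S using Quotient.ind
  induction T using Quotient.ind
  exact Spans.rel_tensor _ _ _ _

lemma rel_precomp {X Y A A' : C} (S : SpanClass X Y) (b : A' ⟶ A) {x : A ⟶ X} {y : A ⟶ Y}
    (h : S.Rel x y) : S.Rel (b ≫ x) (b ≫ y) := by
  induction S using Quotient.ind
  obtain ⟨a, rfl, rfl⟩ := h
  exact ⟨b ≫ a, by simp, by simp⟩

end SpanClass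

variable (C) in
/-- The objects of `Span∼(C)`: those of `C`. -/
structure SpanTilde where
  obj : C

namespace SpanTilde

/-- The class of the span `X ← X → Y` given by a morphism `f : X ⟶ Y`. -/
def graph {X Y : C} (f : X ⟶ Y) : SpanClass X Y := .mk (.of (𝟙 X) f)

/-- The class of the span `Y ← X → X` given by a morphism `f : X ⟶ Y`. -/
def cograph {X Y : C} (f : X ⟶ Y) : SpanClass Y X := .mk (.of f (𝟙 X))

lemma rel_graph {X Y A : C} (f : X ⟶ Y) (x : A ⟶ X) (y : A ⟶ Y) :
    (graph f).Rel x y ↔ x ≫ f = y := by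
  refine (Spans.rel_of _ _ _ _).trans ⟨?_, ?_⟩
  · rintro ⟨a, rfl, rfl⟩; simp
  · rintro rfl; exact ⟨x, by simp, rfl⟩

lemma rel_cograph {X Y A : C} (f : X ⟶ Y) (y : A ⟶ Y) (x : A ⟶ X) :
    (cograph f).Rel y x ↔ x ≫ f = y := by
  refine (Spans.rel_of _ _ _ _).trans ⟨?_, ?_⟩
  · rintro ⟨a, rfl, rfl⟩; simp
  · rintro rfl; exact ⟨x, rfl, by simp⟩

lemma graph_tensor [CartesianMonoidalCategory C] {X Y Z W : C} (f : X ⟶ Y) (g : Z ⟶ W) :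
    SpanClass.tensor (graph f) (graph g) = graph (f ⊗ₘ g) :=
  SpanClass.ext_rel fun x y => by
    rw [SpanClass.rel_tensor, rel_graph, rel_graph, rel_graph]
    constructor
    · rintro ⟨h, h'⟩
      ext
      · simpa using h
      · simpa using h'
    · rintro rfl
      simp

lemma ext_iff' [CartesianMonoidalCategory C] {X Y A : C} (f g : A ⟶ X ⊗ Y) :
    f = g ↔ f ≫ fst X Y = g ≫ fst X Y ∧ f ≫ snd X Y = g ≫ snd X Y :=
  ⟨by rintro rfl; simp, fun h => CartesianMonoidalCategory.hom_ext _ _ h.1 h.2⟩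

lemma exists_lift [CartesianMonoidalCategory C] {X Y A : C} (p : (A ⟶ X ⊗ Y) → Prop) :
    (∃ f, p f) ↔ ∃ (g : A ⟶ X) (h : A ⟶ Y), p (lift g h) :=
  ⟨fun ⟨f, hf⟩ => ⟨f ≫ fst _ _, f ≫ snd _ _, by simpa using hf⟩, fun ⟨g, h, hp⟩ => ⟨_, hp⟩⟩

section Coherence

variable [CartesianMonoidalCategory C]

lemma symm_aux [BraidedCategory C] (X Y : C) : (β_ X Y).hom ≫ (β_ Y X).hom = 𝟙 (X ⊗ Y) := by
  ext <;> simp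

lemma diag_left_aux (X : C) :
    lift (𝟙 X) (𝟙 X) ≫ (toUnit X ⊗ₘ 𝟙 X) = (λ_ X).inv := by
  ext; simp

lemma diag_right_aux (X : C) :
    lift (𝟙 X) (𝟙 X) ≫ (𝟙 X ⊗ₘ toUnit X) = (ρ_ X).inv := by
  ext; simp

lemma diag_assoc_aux (X : C) :
    lift (𝟙 X) (𝟙 X) ≫ (𝟙 X ⊗ₘ lift (𝟙 X) (𝟙 X)) =
      lift (𝟙 X) (𝟙 X) ≫ (lift (𝟙 X) (𝟙 X) ⊗ₘ 𝟙 X) ≫ (α_ X X X).hom := by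
  ext <;> simp

lemma diag_comm_aux [BraidedCategory C] (X : C) : lift (𝟙 X) (𝟙 X) ≫ (β_ X X).hom = lift (𝟙 X) (𝟙 X) := by
  ext <;> simp

lemma diag_tensor_aux [BraidedCategory C] (X Y : C) :
    lift (𝟙 (X ⊗ Y)) (𝟙 (X ⊗ Y)) =
      (lift (𝟙 X) (𝟙 X) ⊗ₘ lift (𝟙 Y) (𝟙 Y)) ≫ tensorμ X X Y Y := by
  ext <;> simp

lemma diag_unit_aux : lift (𝟙 (𝟙_ C)) (𝟙 (𝟙_ C)) = (λ_ (𝟙_ C)).inv := by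
  ext

end Coherence

variable [HasWeakPullbacks C]

noncomputable instance : Category (SpanTilde C) where
  Hom X Y := SpanClass X.obj Y.obj
  id X := graph (𝟙 X.obj)
  comp S T := SpanClass.comp S T
  id_comp S := SpanClass.ext_rel fun x y => by simp [SpanClass.rel_comp, rel_graph]
  comp_id S := SpanClass.ext_rel fun x y => by simp [SpanClass.rel_comp, rel_graph]
  assoc S T U := SpanClass.ext_rel fun x y => by simp [SpanClass.rel_comp]; tauto

lemma id_eq (X : SpanTilde C) : 𝟙 X = graph (𝟙 X.obj) := rfl

lemma comp_eq {X Y Z : SpanTilde C} (S : X ⟶ Y) (T : Y ⟶ Z) : S ≫ T = SpanClass.comp S T := rfl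

lemma graph_comp {X Y Z : C} (f : X ⟶ Y) (g : Y ⟶ Z) :
    SpanClass.comp (graph f) (graph g) = graph (f ≫ g) :=
  SpanClass.ext_rel fun x y => by simp [SpanClass.rel_comp, rel_graph]

/-- The isomorphism of `Span∼(C)` given by an isomorphism of `C`. -/
@[simps]
def graphIso {X Y : SpanTilde C} (e : X.obj ≅ Y.obj) : X ≅ Y where
  hom := graph e.hom
  inv := graph e.inv
  hom_inv_id := (graph_comp _ _).trans (by rw [e.hom_inv_id, id_eq])
  inv_hom_id := (graph_comp _ _).trans (by rw [e.inv_hom_id, id_eq])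

section Naturality

lemma comp_graph_iso {X Y Z : C} (f : SpanClass X Y) (e : Y ≅ Z) {A : C} (x : A ⟶ X)
    (z : A ⟶ Z) : (f.comp (graph e.hom)).Rel x z ↔ f.Rel x (z ≫ e.inv) := by
  simp only [SpanClass.rel_comp, rel_graph, ← Iso.eq_comp_inv, exists_eq_right]

lemma graph_comp_rel {X Y Z : C} (f : X ⟶ Y) (g : SpanClass Y Z) {A : C} (x : A ⟶ X)
    (z : A ⟶ Z) : ((graph f).comp g).Rel x z ↔ g.Rel (x ≫ f) z := by
  simp only [SpanClass.rel_comp, rel_graph, exists_eq_left']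

variable [CartesianMonoidalCategory C]

lemma tensor_comp {X₁ X₂ Y₁ Y₂ Z₁ Z₂ : C} (f₁ : SpanClass X₁ Y₁) (f₂ : SpanClass X₂ Y₂)
    (g₁ : SpanClass Y₁ Z₁) (g₂ : SpanClass Y₂ Z₂) :
    (f₁.tensor f₂).comp (g₁.tensor g₂) = (f₁.comp g₁).tensor (f₂.comp g₂) :=
  SpanClass.ext_rel fun x y => by
    simp only [SpanClass.rel_comp, SpanClass.rel_tensor]
    constructor
    · rintro ⟨z, ⟨h₁, h₂⟩, h₃, h₄⟩
      exact ⟨⟨_, h₁, h₃⟩, ⟨_, h₂, h₄⟩⟩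
    · rintro ⟨⟨a, h₁, h₃⟩, ⟨b, h₂, h₄⟩⟩
      exact ⟨lift a b, by rw [lift_fst, lift_snd]; exact ⟨⟨h₁, h₂⟩, h₃, h₄⟩⟩

lemma tensor_associator {X₁ X₂ X₃ Y₁ Y₂ Y₃ : C} (f : SpanClass X₁ Y₁) (g : SpanClass X₂ Y₂)
    (h : SpanClass X₃ Y₃) :
    ((f.tensor g).tensor h).comp (graph (α_ Y₁ Y₂ Y₃).hom) =
      (graph (α_ X₁ X₂ X₃).hom).comp (f.tensor (g.tensor h)) :=
  SpanClass.ext_rel fun x y => by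
    rw [comp_graph_iso, graph_comp_rel]
    simp [SpanClass.rel_tensor, and_assoc]

lemma tensor_leftUnitor {X Y : C} (f : SpanClass X Y) :
    ((graph (𝟙 (𝟙_ C))).tensor f).comp (graph (λ_ Y).hom) = (graph (λ_ X).hom).comp f :=
  SpanClass.ext_rel fun {A} x y => by
    rw [comp_graph_iso, graph_comp_rel]
    simp [SpanClass.rel_tensor, leftUnitor_hom, rel_graph, toUnit_unique (x ≫ fst (𝟙_ C) X) (toUnit A)]

lemma tensor_rightUnitor {X Y : C} (f : SpanClass X Y) :
    (f.tensor (graph (𝟙 (𝟙_ C)))).comp (graph (ρ_ Y).hom) = (graph (ρ_ X).hom).comp f :=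
  SpanClass.ext_rel fun {A} x y => by
    rw [comp_graph_iso, graph_comp_rel]
    simp [SpanClass.rel_tensor, rightUnitor_hom, rel_graph, toUnit_unique (x ≫ snd X (𝟙_ C)) (toUnit A)]

lemma tensor_braiding [BraidedCategory C] {X₁ X₂ Y₁ Y₂ : C} (f : SpanClass X₁ Y₁)
    (g : SpanClass X₂ Y₂) :
    (f.tensor g).comp (graph (β_ Y₁ Y₂).hom) = (graph (β_ X₁ X₂).hom).comp (g.tensor f) :=
  SpanClass.ext_rel fun x y => by
    rw [comp_graph_iso, graph_comp_rel]
    simp [SpanClass.rel_tensor, and_comm]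

lemma cocopy_copy_rel {X A : C} (x y : A ⟶ X ⊗ X) :
    ((cograph (lift (𝟙 X) (𝟙 X))).comp (graph (lift (𝟙 X) (𝟙 X)))).Rel x y ↔
      x ≫ fst X X = y ≫ fst X X ∧ x ≫ fst X X = y ≫ snd X X ∧ x ≫ snd X X = y ≫ snd X X := by
  rw [SpanClass.rel_comp]
  constructor
  · rintro ⟨z, a, b⟩
    obtain rfl := (rel_graph _ _ _).1 b
    obtain rfl := (rel_cograph _ _ _).1 a
    simp
  · rintro ⟨a, b, c⟩
    refine ⟨x ≫ fst X X, (rel_cograph _ _ _).2 ?_, (rel_graph _ _ _).2 ?_⟩ <;> ext <;> simp_all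

lemma frobenius_left_aux (X : C) :
    ((graph (lift (𝟙 X) (𝟙 X))).tensor (graph (𝟙 X))).comp ((graph (α_ X X X).hom).comp
      ((graph (𝟙 X)).tensor (cograph (lift (𝟙 X) (𝟙 X))))) =
    (cograph (lift (𝟙 X) (𝟙 X))).comp (graph (lift (𝟙 X) (𝟙 X))) :=
  SpanClass.ext_rel fun x y => by
    rw [graph_tensor, graph_comp_rel, graph_comp_rel, cocopy_copy_rel, SpanClass.rel_tensor,
      rel_graph, rel_cograph, ext_iff' (_ ≫ _)]
    simp [eq_comm]

lemma frobenius_right_aux (X : C) :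
    ((graph (𝟙 X)).tensor (graph (lift (𝟙 X) (𝟙 X)))).comp ((graph (α_ X X X).inv).comp
      ((cograph (lift (𝟙 X) (𝟙 X))).tensor (graph (𝟙 X)))) =
    (cograph (lift (𝟙 X) (𝟙 X))).comp (graph (lift (𝟙 X) (𝟙 X))) :=
  SpanClass.ext_rel fun x y => by
    rw [graph_tensor, graph_comp_rel, graph_comp_rel, cocopy_copy_rel, SpanClass.rel_tensor,
      rel_graph, rel_cograph, ext_iff' (_ ≫ _)]
    simp
    grind

end Naturality

variable [CartesianMonoidalCategory C]

noncomputable instance : MonoidalCategoryStruct (SpanTilde C) where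
  tensorObj X Y := ⟨X.obj ⊗ Y.obj⟩
  tensorHom S T := SpanClass.tensor S T
  whiskerLeft X _ _ S := SpanClass.tensor (graph (𝟙 X.obj)) S
  whiskerRight S X := SpanClass.tensor S (graph (𝟙 X.obj))
  tensorUnit := ⟨𝟙_ C⟩
  associator X Y Z := graphIso (α_ X.obj Y.obj Z.obj)
  leftUnitor X := graphIso (λ_ X.obj)
  rightUnitor X := graphIso (ρ_ X.obj)

lemma tensorHom_eq {X Y Z W : SpanTilde C} (S : X ⟶ Y) (T : Z ⟶ W) :
    S ⊗ₘ T = SpanClass.tensor S T := rfl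

lemma whiskerLeft_eq (X : SpanTilde C) {Y Z : SpanTilde C} (S : Y ⟶ Z) :
    X ◁ S = SpanClass.tensor (graph (𝟙 X.obj)) S := rfl

lemma whiskerRight_eq {Y Z : SpanTilde C} (S : Y ⟶ Z) (X : SpanTilde C) :
    S ▷ X = SpanClass.tensor S (graph (𝟙 X.obj)) := rfl

lemma associator_hom_eq (X Y Z : SpanTilde C) :
    (α_ X Y Z).hom = graph (α_ X.obj Y.obj Z.obj).hom := rfl

lemma associator_inv_eq (X Y Z : SpanTilde C) :
    (α_ X Y Z).inv = graph (α_ X.obj Y.obj Z.obj).inv := rfl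

lemma leftUnitor_hom_eq (X : SpanTilde C) : (λ_ X).hom = graph (λ_ X.obj).hom := rfl

lemma leftUnitor_inv_eq (X : SpanTilde C) : (λ_ X).inv = graph (λ_ X.obj).inv := rfl

lemma rightUnitor_hom_eq (X : SpanTilde C) : (ρ_ X).hom = graph (ρ_ X.obj).hom := rfl

lemma rightUnitor_inv_eq (X : SpanTilde C) : (ρ_ X).inv = graph (ρ_ X.obj).inv := rfl

noncomputable instance : MonoidalCategory (SpanTilde C) :=
  MonoidalCategory.ofTensorHom
    (id_tensorHom_id := fun X Y => (graph_tensor _ _).trans (congrArg graph (id_tensorHom_id _ _)))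
    (id_tensorHom := fun X _ _ f => rfl)
    (tensorHom_id := fun f Y => rfl)
    (tensorHom_comp_tensorHom := fun f₁ f₂ g₁ g₂ => tensor_comp f₁ f₂ g₁ g₂)
    (associator_naturality := fun f g h => tensor_associator f g h)
    (leftUnitor_naturality := fun f => tensor_leftUnitor f)
    (rightUnitor_naturality := fun f => tensor_rightUnitor f)
    (pentagon := fun W X Y Z => by
      change ((graph _).tensor (graph _)).comp ((graph _).comp ((graph _).tensor (graph _))) =
        (graph _).comp (graph _)
      simp only [graph_tensor, graph_comp, tensorHom_id, id_tensorHom]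
      exact congrArg graph (MonoidalCategory.pentagon _ _ _ _))
    (triangle := fun X Y => by
      change (graph _).comp ((graph _).tensor (graph _)) = (graph _).tensor (graph _)
      simp only [graph_tensor, graph_comp, tensorHom_id, id_tensorHom]
      exact congrArg graph (MonoidalCategory.triangle _ _))

variable [BraidedCategory C]

noncomputable instance : SymmetricCategory (SpanTilde C) where
  braiding X Y := graphIso (β_ X.obj Y.obj)
  braiding_naturality_right X _ _ f := tensor_braiding (graph (𝟙 X.obj)) f
  braiding_naturality_left f X := tensor_braiding f (graph (𝟙 X.obj))
  hexagon_forward X Y Z := by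
    change (graph _).comp ((graph _).comp (graph _)) =
      ((graph _).tensor (graph _)).comp ((graph _).comp ((graph _).tensor (graph _)))
    simp only [graph_tensor, graph_comp, tensorHom_id, id_tensorHom]
    exact congrArg graph (BraidedCategory.hexagon_forward _ _ _)
  hexagon_reverse X Y Z := by
    change (graph _).comp ((graph _).comp (graph _)) =
      ((graph _).tensor (graph _)).comp ((graph _).comp ((graph _).tensor (graph _)))
    simp only [graph_tensor, graph_comp, tensorHom_id, id_tensorHom]
    exact congrArg graph (BraidedCategory.hexagon_reverse _ _ _)
  symmetry X Y := (graph_comp _ _).trans (congrArg graph (symm_aux _ _))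

/-- The comonoid on `X` has the spans of the diagonal `X → X × X` and of `X → 1`. -/
noncomputable instance (X : SpanTilde C) : ComonObj X where
  comul := graph (lift (𝟙 X.obj) (𝟙 X.obj))
  counit := graph (toUnit X.obj)
  counit_comul := by
    change (graph _).comp ((graph _).tensor (graph _)) = graph _
    simp only [graph_tensor, graph_comp]
    exact congrArg graph (diag_left_aux _)
  comul_counit := by
    change (graph _).comp ((graph _).tensor (graph _)) = graph _
    simp only [graph_tensor, graph_comp]
    exact congrArg graph (diag_right_aux _)
  comul_assoc := by
    change (graph _).comp ((graph _).tensor (graph _)) =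
      (graph _).comp (((graph _).tensor (graph _)).comp (graph _))
    simp only [graph_tensor, graph_comp]
    exact congrArg graph (diag_assoc_aux _)

instance (X : SpanTilde C) : IsCommComonObj X where
  comul_comm := (graph_comp _ _).trans (congrArg graph (diag_comm_aux _))

lemma tensorμ_eq (X Y Z W : SpanTilde C) :
    tensorμ X Y Z W = graph (tensorμ X.obj Y.obj Z.obj W.obj) := by
  change (graph _).comp (((graph _).tensor (graph _)).comp
    (((graph _).tensor ((graph _).tensor (graph _))).comp
      (((graph _).tensor (graph _)).comp (graph _)))) = graph _
  simp only [graph_tensor, graph_comp, tensorHom_id, id_tensorHom]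
  rfl

noncomputable instance : CopyDiscardCategory (SpanTilde C) where
  copy_tensor X Y := by
    rw [tensorμ_eq]
    change graph _ = ((graph _).tensor (graph _)).comp (graph _)
    simp only [graph_tensor, graph_comp]
    exact congrArg graph (diag_tensor_aux _ _)
  discard_tensor X Y := by
    change graph _ = ((graph _).tensor (graph _)).comp (graph _)
    simp only [graph_tensor, graph_comp]
    exact congrArg graph (toUnit_unique _ _)
  copy_unit := congrArg graph diag_unit_aux
  discard_unit := congrArg graph (toUnit_unique _ _)

/-- The adjoints of the comonoid on `X` are the spans `X × X ← X → X` and `1 ← X → X`. -/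
noncomputable instance : CartesianBicategory (SpanTilde C) where
  homOrder X Y := inferInstanceAs (PartialOrder (SpanClass X.obj Y.obj))
  comp_mono {X Y Z R R' S S'} h h' := SpanClass.le_iff.2 fun x z k => by
    obtain ⟨y, a, b⟩ := (SpanClass.rel_comp _ _ _ _).1 k
    exact (SpanClass.rel_comp _ _ _ _).2
      ⟨y, SpanClass.le_iff.1 h _ _ a, SpanClass.le_iff.1 h' _ _ b⟩
  tensor_mono {X Y Z W R R' S S'} h h' := SpanClass.le_iff.2 fun x z k => by
    obtain ⟨a, b⟩ := (SpanClass.rel_tensor _ _ _ _).1 k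
    exact (SpanClass.rel_tensor _ _ _ _).2
      ⟨SpanClass.le_iff.1 h _ _ a, SpanClass.le_iff.1 h' _ _ b⟩
  cocopy X := cograph (lift (𝟙 X.obj) (𝟙 X.obj))
  codiscard X := cograph (toUnit X.obj)
  copy_unit_le X := SpanClass.le_iff.2 fun x y h =>
    (graph_comp_rel _ _ _ _).2 ((rel_cograph _ _ _).2 (by
      obtain rfl := (rel_graph _ _ _).1 h
      simp))
  copy_counit_le X := SpanClass.le_iff.2 fun x y h => by
    obtain ⟨z, a, b⟩ := (SpanClass.rel_comp _ _ _ _).1 h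
    exact (rel_graph _ _ _).2 ((Category.comp_id _).trans
      (((rel_cograph _ _ _).1 a).symm.trans ((rel_graph _ _ _).1 b)))
  discard_unit_le X := SpanClass.le_iff.2 fun x y h =>
    (graph_comp_rel _ _ _ _).2 ((rel_cograph _ _ _).2 (toUnit_unique _ _))
  discard_counit_le X := SpanClass.le_iff.2 fun x y h =>
    (rel_graph _ _ _).2 (toUnit_unique _ _)
  frobenius_left X := frobenius_left_aux X.obj
  frobenius_right X := frobenius_right_aux X.obj
  lax_copy {X Y} R := SpanClass.le_iff.2 fun x y h => by
    obtain ⟨z, a, b⟩ := (SpanClass.rel_comp _ _ _ _).1 h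
    obtain rfl := (rel_graph _ _ _).1 b
    refine (graph_comp_rel _ _ _ _).2 ((SpanClass.rel_tensor _ _ _ _).2 ?_)
    simpa using a
  lax_discard {X Y} R := SpanClass.le_iff.2 fun x y h =>
    (rel_graph _ _ _).2 (toUnit_unique _ _)

end SpanTilde

end Spans

section Morphisms

/-- A morphism of cartesian bicategories: a (strong, symmetric) monoidal functor that preserves the
order, the comonoids and their adjoint monoids. -/
structure Morphism (B : Type u₁) [Category.{v₁} B] [MonoidalCategory B] [CartesianBicategory B]
    (B' : Type u₂) [Category.{v₂} B'] [MonoidalCategory B'] [CartesianBicategory B']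
    extends B ⥤ B' where
  [braided : toFunctor.Braided]
  map_mono {X Y : B} {R S : X ⟶ Y} : R ≤ S → map R ≤ map S
  map_copy (X : B) : map Δ[X] = Δ[obj X] ≫ Functor.LaxMonoidal.μ toFunctor X X
  map_discard (X : B) : map ε[X] = ε[obj X] ≫ Functor.LaxMonoidal.ε toFunctor
  map_cocopy (X : B) :
    Functor.LaxMonoidal.μ toFunctor X X ≫ map (cocopy X) = cocopy (obj X)
  map_codiscard (X : B) :
    Functor.LaxMonoidal.ε toFunctor ≫ map (codiscard X) = codiscard (obj X)

/-- An isomorphism of cartesian bicategories: a pair of mutually inverse morphisms. (The coherence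
isomorphisms `μ` and `ε` of a morphism are determined by its underlying functor, since they are
compatible with the product projections in the categories of maps; hence those of the two composites
are automatically those of the identity functors.) -/
structure Isomorphism (B : Type u₁) [Category.{v₁} B] [MonoidalCategory B] [CartesianBicategory B]
    (B' : Type u₂) [Category.{v₂} B'] [MonoidalCategory B'] [CartesianBicategory B'] where
  hom : Morphism B B'
  inv : Morphism B' B
  hom_inv_id : hom.toFunctor ⋙ inv.toFunctor = 𝟭 B
  inv_hom_id : inv.toFunctor ⋙ hom.toFunctor = 𝟭 B'

end Morphisms

end CartBicat

/-!
A cartesian bicategory is thought of as a category of relations; when it has enough maps, a morphism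
is determined by the pairs of maps it relates: for maps `x : T ⟶ X` and `y : T ⟶ Y` and a morphism `R : X ⟶ Y`, say that
`R` relates `x` and `y` when `y ≤ x ; R`.

The Frobenius law makes every object self-dual, so that a map `f` has `fᵒᵖ` as right adjoint
(`IsMap.isAdj`) and satisfies Frobenius reciprocity (`IsMap.whiskerLeft_cocopy`). Applying the
existence of enough maps to a bent morphism `Y ⊗ X ⟶ I` writes every `R : X ⟶ Y` as `fᵒᵖ ; g` for a
span of maps (`HasEnoughMaps.exists_tabulation`).

The axiom of choice enters through one lifting property: if `y ≤ Q ; g` with `y` and `g` maps, then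
some map `a ≤ Q` satisfies `a ; g = y` (`HasChoice.exists_map_le`), since the intersection of `Q` with
`y ; gᵒᵖ` is total. Hence `fᵒᵖ ; g` relates `x` and `y` exactly when `(x, y)` factors through the span
`(f, g)`. So tabulations of `f ; gᵒᵖ` are weak pullbacks, and sending `R` to the class of its
tabulation is an order isomorphism onto classes of spans of maps (`spanEquiv`). Composition and tensor
of span classes are described by generalised elements in the same way as those of `B`, which makes
this bijection an isomorphism of cartesian bicategories (`spanIsomorphism`).

Conversely, choice always holds in `Span∼(C)`: a total span has a left leg with a section
(`hasChoice_spanTilde`). Morphisms of cartesian bicategories preserve total morphisms and maps, so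
choice is transported along an isomorphism (`Isomorphism.hasChoice`).
-/

namespace CartBicat

open MonoidalCategory Limits CartesianMonoidalCategory CartesianBicategory
open scoped ComonObj

section Calculus

variable {B : Type u} [Category.{v} B] [MonoidalCategory B] [CartesianBicategory B]

/-! ### Adjunctions in the poset-enriched category -/

/-- `g` is right adjoint to `f` in the poset-enriched category `B`. -/
structure IsAdj {X Y : B} (f : X ⟶ Y) (g : Y ⟶ X) : Prop where
  unit : 𝟙 X ≤ f ≫ g
  counit : g ≫ f ≤ 𝟙 Y

namespace IsAdj

lemma comp_left_le_iff {X Y Z : B} {f : X ⟶ Y} {g : Y ⟶ X} (h : IsAdj f g)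
    (R : Z ⟶ X) (S : Z ⟶ Y) : R ≫ f ≤ S ↔ R ≤ S ≫ g := by
  constructor
  · intro k
    calc R = R ≫ 𝟙 X := by simp
      _ ≤ R ≫ f ≫ g := comp_mono le_rfl h.unit
      _ = (R ≫ f) ≫ g := by simp
      _ ≤ S ≫ g := comp_mono k le_rfl
  · intro k
    calc R ≫ f ≤ (S ≫ g) ≫ f := comp_mono k le_rfl
      _ = S ≫ g ≫ f := by simp
      _ ≤ S ≫ 𝟙 Y := comp_mono le_rfl h.counit
      _ = S := by simp

lemma right_comp_le_iff {X Y Z : B} {f : X ⟶ Y} {g : Y ⟶ X} (h : IsAdj f g)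
    (R : X ⟶ Z) (S : Y ⟶ Z) : g ≫ R ≤ S ↔ R ≤ f ≫ S := by
  constructor
  · intro k
    calc R = 𝟙 X ≫ R := by simp
      _ ≤ (f ≫ g) ≫ R := comp_mono h.unit le_rfl
      _ = f ≫ g ≫ R := by simp
      _ ≤ f ≫ S := comp_mono le_rfl k
  · intro k
    calc g ≫ R ≤ g ≫ f ≫ S := comp_mono le_rfl k
      _ = (g ≫ f) ≫ S := by simp
      _ ≤ 𝟙 Y ≫ S := comp_mono h.counit le_rfl
      _ = S := by simp

lemma unique {X Y : B} {f : X ⟶ Y} {g g' : Y ⟶ X} (h : IsAdj f g) (h' : IsAdj f g') :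
    g = g' := by
  apply le_antisymm
  · simpa using (h'.comp_left_le_iff g (𝟙 Y)).1 h.counit
  · simpa using (h.comp_left_le_iff g' (𝟙 Y)).1 h'.counit

lemma comp {X Y Z : B} {f : X ⟶ Y} {g : Y ⟶ X} {f' : Y ⟶ Z} {g' : Z ⟶ Y} (h : IsAdj f g)
    (h' : IsAdj f' g') : IsAdj (f ≫ f') (g' ≫ g) where
  unit := by
    have := (h'.comp_left_le_iff f (f ≫ f')).1 le_rfl
    calc 𝟙 X ≤ f ≫ g := h.unit
      _ ≤ ((f ≫ f') ≫ g') ≫ g := comp_mono this le_rfl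
      _ = _ := by simp
  counit := by
    calc (g' ≫ g) ≫ f ≫ f' = g' ≫ (g ≫ f) ≫ f' := by simp
      _ ≤ g' ≫ 𝟙 Y ≫ f' := comp_mono le_rfl (comp_mono h.counit le_rfl)
      _ ≤ 𝟙 Z := by simpa using h'.counit

lemma tensor {X Y Z W : B} {f : X ⟶ Y} {g : Y ⟶ X} {f' : Z ⟶ W} {g' : W ⟶ Z} (h : IsAdj f g)
    (h' : IsAdj f' g') : IsAdj (f ⊗ₘ f') (g ⊗ₘ g') where
  unit := by
    rw [tensorHom_comp_tensorHom, ← id_tensorHom_id]; exact tensor_mono h.unit h'.unit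
  counit := by
    rw [tensorHom_comp_tensorHom, ← id_tensorHom_id]; exact tensor_mono h.counit h'.counit

lemma of_iso {X Y : B} (e : X ≅ Y) : IsAdj e.hom e.inv := ⟨by simp, by simp⟩

end IsAdj

lemma isAdj_copy (X : B) : IsAdj Δ[X] (cocopy X) := ⟨copy_unit_le X, copy_counit_le X⟩

lemma isAdj_discard (X : B) : IsAdj ε[X] (codiscard X) := ⟨discard_unit_le X, discard_counit_le X⟩

lemma whiskerLeft_mono (X : B) {Y Z : B} {R S : Y ⟶ Z} (h : R ≤ S) : X ◁ R ≤ X ◁ S := by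
  rw [← id_tensorHom, ← id_tensorHom]; exact tensor_mono le_rfl h

lemma whiskerRight_mono (X : B) {Y Z : B} {R S : Y ⟶ Z} (h : R ≤ S) : R ▷ X ≤ S ▷ X := by
  rw [← tensorHom_id, ← tensorHom_id]; exact tensor_mono h le_rfl

lemma codiscard_cocopy_left (X : B) : codiscard X ▷ X ≫ cocopy X = (λ_ X).hom := by
  have h : IsAdj (Δ[X] ≫ ε[X] ▷ X) (codiscard X ▷ X ≫ cocopy X) := by
    rw [← tensorHom_id, ← tensorHom_id]
    exact (isAdj_copy X).comp ((isAdj_discard X).tensor (IsAdj.of_iso (Iso.refl X)))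
  rw [ComonObj.counit_comul] at h
  exact h.unique (IsAdj.of_iso (λ_ X).symm)

lemma codiscard_cocopy_right (X : B) : X ◁ codiscard X ≫ cocopy X = (ρ_ X).hom := by
  have h : IsAdj (Δ[X] ≫ X ◁ ε[X]) (X ◁ codiscard X ≫ cocopy X) := by
    rw [← id_tensorHom, ← id_tensorHom]
    exact (isAdj_copy X).comp ((IsAdj.of_iso (Iso.refl X)).tensor (isAdj_discard X))
  rw [ComonObj.comul_counit] at h
  exact h.unique (IsAdj.of_iso (ρ_ X).symm)

/-- Every morphism is a lax homomorphism of the adjoint monoids: this is the mate of `lax_copy`. -/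
lemma cocopy_lax {X Y : B} (R : X ⟶ Y) : cocopy X ≫ R ≤ (R ⊗ₘ R) ≫ cocopy Y := by
  rw [(isAdj_copy X).right_comp_le_iff, ← Category.assoc, ← (isAdj_copy Y).comp_left_le_iff]
  exact lax_copy R

/-! ### The compact closed structure -/

/-- The cup on `X`, the unit of the self-duality of `X`. -/
abbrev cup (X : B) : 𝟙_ B ⟶ X ⊗ X := codiscard X ≫ Δ[X]

/-- The cap on `X`, the counit of the self-duality of `X`. -/
abbrev cap (X : B) : X ⊗ X ⟶ 𝟙_ B := cocopy X ≫ ε[X]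

lemma cocopy_eq_cap (X : B) :
    cocopy X = X ◁ Δ[X] ≫ (α_ X X X).inv ≫ cap X ▷ X ≫ (λ_ X).hom := by
  have := frobenius_right X
  rw [comp_whiskerRight, Category.assoc, reassoc_of% this]
  simp

lemma cup_cap_left (X : B) :
    X ◁ cup X ≫ (α_ X X X).inv ≫ cap X ▷ X = (ρ_ X).hom ≫ (λ_ X).inv := by
  rw [MonoidalCategory.whiskerLeft_comp, comp_whiskerRight, Category.assoc,
    reassoc_of% (frobenius_right X), reassoc_of% (codiscard_cocopy_right X),
    ComonObj.counit_comul]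

lemma cup_cap_right (X : B) :
    cup X ▷ X ≫ (α_ X X X).hom ≫ X ◁ cap X = (λ_ X).hom ≫ (ρ_ X).inv := by
  rw [MonoidalCategory.whiskerLeft_comp, comp_whiskerRight, Category.assoc,
    reassoc_of% (frobenius_left X), reassoc_of% (codiscard_cocopy_left X),
    ComonObj.comul_counit]

/-- Every object is its own dual, by the Frobenius law. With these duals, `opposite` is Mathlib's
`rightAdjointMate`. -/
abbrev selfRightDual (X : B) : HasRightDual X where
  rightDual := X
  exact :=
    { coevaluation' := cup X
      evaluation' := cap X
      coevaluation_evaluation' := cup_cap_left X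
      evaluation_coevaluation' := cup_cap_right X }

lemma opposite_cap {X Y : B} (f : X ⟶ Y) : opposite f ▷ X ≫ cap X = Y ◁ f ≫ cap Y :=
  @rightAdjointMate_comp_evaluation _ _ _ X Y (selfRightDual X) (selfRightDual Y) f

lemma opposite_comp {X Y Z : B} (f : X ⟶ Y) (g : X ⟶ Z) : opposite f ≫ g =
    (ρ_ Y).inv ≫ Y ◁ (cup X ≫ (f ⊗ₘ g)) ≫ (α_ Y Y Z).inv ≫ cap Y ▷ Z ≫ (λ_ Z).hom := by
  rw [MonoidalCategory.whiskerLeft_comp, Category.assoc]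
  exact @rightAdjointMate_comp _ _ _ X Y Z (selfRightDual X) (selfRightDual Y) f g

lemma snake (X : B) :
    (ρ_ X).inv ≫ X ◁ cup X ≫ (α_ X X X).inv ≫ cap X ▷ X ≫ (λ_ X).hom = 𝟙 X := by
  rw [reassoc_of% (cup_cap_left X)]
  simp

lemma comp_opposite {X Y : B} (f : X ⟶ Y) : f ≫ opposite f =
    (ρ_ X).inv ≫ X ◁ cup X ≫ (α_ X X X).inv ≫ ((f ⊗ₘ f) ≫ cap Y) ▷ X ≫ (λ_ X).hom := by
  calc f ≫ opposite f = (ρ_ X).inv ≫ (f ▷ _ ≫ Y ◁ cup X) ≫ Y ◁ (f ▷ X) ≫ (α_ Y Y X).inv ≫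
        cap Y ▷ X ≫ (λ_ X).hom := by simp [opposite]
    _ = _ := by
      rw [← whisker_exchange, MonoidalCategory.tensorHom_def]
      monoidal

/-- For a map `f`, one has `cup ; (f ⊗ f) ≤ cup` and `cap ≤ (f ⊗ f) ; cap`. These inequalities turn
the snake equation into the adjunction between a map and its opposite. -/
lemma IsMap.isAdj {X Y : B} {f : X ⟶ Y} (hf : IsMap f) : IsAdj f (opposite f) where
  unit := by
    rw [comp_opposite, ← snake X]
    refine comp_mono le_rfl (comp_mono le_rfl (comp_mono le_rfl (comp_mono
      (whiskerRight_mono _ ?_) le_rfl)))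
    calc cap X = (cocopy X ≫ f) ≫ ε[Y] := by rw [Category.assoc, ((isMap_iff f).1 hf).2]
      _ ≤ ((f ⊗ₘ f) ≫ cocopy Y) ≫ ε[Y] := comp_mono (cocopy_lax f) le_rfl
      _ = _ := by simp
  counit := by
    rw [opposite_comp, ← snake Y]
    refine comp_mono le_rfl (comp_mono (whiskerLeft_mono _ ?_) le_rfl)
    calc cup X ≫ (f ⊗ₘ f) = (codiscard X ≫ f) ≫ Δ[Y] := by
          rw [Category.assoc, Category.assoc, ((isMap_iff f).1 hf).1]
      _ ≤ codiscard Y ≫ Δ[Y] := comp_mono ?_ le_rfl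
    simpa using ((isAdj_discard Y).comp_left_le_iff (codiscard X ≫ f) (𝟙 _)).1 (by
      rw [Category.assoc, ((isMap_iff f).1 hf).2]; exact discard_counit_le X)

lemma opposite_mono {X Y : B} {R S : X ⟶ Y} (h : R ≤ S) : opposite R ≤ opposite S :=
  comp_mono le_rfl (comp_mono le_rfl (comp_mono (whiskerLeft_mono _ (whiskerRight_mono _ h)) le_rfl))

/-- Comparable maps are equal: `opposite` is monotone, being obtained by bending wires, and on maps
it is also antitone, being a right adjoint. -/
lemma IsMap.eq_of_le {X Y : B} {f g : X ⟶ Y} (hf : IsMap f) (hg : IsMap g) (h : f ≤ g) :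
    f = g := by
  refine le_antisymm h ?_
  calc g = 𝟙 X ≫ g := by simp
    _ ≤ (f ≫ opposite f) ≫ g := comp_mono hf.isAdj.unit le_rfl
    _ ≤ (f ≫ opposite g) ≫ g := comp_mono (comp_mono le_rfl (opposite_mono h)) le_rfl
    _ = f ≫ opposite g ≫ g := by simp
    _ ≤ f ≫ 𝟙 Y := comp_mono le_rfl hg.isAdj.counit
    _ = f := by simp

/-- The Frobenius reciprocity law for a map. Writing `cocopy` as a copy followed by a cap, the map `g`
is copied, and one of the copies is moved to the other side of the cap, where it becomes its
opposite. -/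
lemma IsMap.whiskerLeft_cocopy {X Y : B} {g : X ⟶ Y} (hg : IsMap g) :
    Y ◁ g ≫ cocopy Y = opposite g ▷ X ≫ cocopy X ≫ g := by
  calc Y ◁ g ≫ cocopy Y
      = Y ◁ (g ≫ Δ[Y]) ≫ (α_ Y Y Y).inv ≫ cap Y ▷ Y ≫ (λ_ Y).hom := by
        rw [cocopy_eq_cap, MonoidalCategory.whiskerLeft_comp]; simp
    _ = Y ◁ Δ[X] ≫ (α_ Y X X).inv ≫ (Y ◁ g) ▷ X ≫ ((Y ⊗ Y) ◁ g ≫ cap Y ▷ Y) ≫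
          (λ_ Y).hom := by
        rw [((isMap_iff g).1 hg).1, MonoidalCategory.tensorHom_def]; monoidal
    _ = Y ◁ Δ[X] ≫ (α_ Y X X).inv ≫ (Y ◁ g ≫ cap Y) ▷ X ≫ (λ_ X).hom ≫ g := by
        rw [whisker_exchange]; monoidal
    _ = (Y ◁ Δ[X] ≫ opposite g ▷ (X ⊗ X)) ≫ (α_ X X X).inv ≫ cap X ▷ X ≫ (λ_ X).hom ≫ g := by
        rw [← opposite_cap]; monoidal
    _ = _ := by rw [whisker_exchange, cocopy_eq_cap X]; simp only [Category.assoc]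

/-- A morphism is determined by the result of bending its output wire. -/
lemma whiskerLeft_cap_injective {X Y : B} {R S : X ⟶ Y}
    (h : Y ◁ R ≫ cap Y = Y ◁ S ≫ cap Y) : R = S := by
  have key (T : X ⟶ Y) : T = (λ_ X).inv ≫ cup Y ▷ X ≫ (α_ Y Y X).hom ≫ Y ◁ (Y ◁ T ≫ cap Y) ≫
      (ρ_ Y).hom := by
    calc T = (λ_ X).inv ≫ _ ◁ T ≫ (cup Y ▷ Y ≫ (α_ Y Y Y).hom ≫ Y ◁ cap Y) ≫ (ρ_ Y).hom := by
          rw [cup_cap_right]; simp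
      _ = (λ_ X).inv ≫ (_ ◁ T ≫ cup Y ▷ Y) ≫ (α_ Y Y Y).hom ≫ Y ◁ cap Y ≫ (ρ_ Y).hom := by simp
      _ = _ := by rw [whisker_exchange]; simp
  rw [key R, key S, h]

/-! ### Intersections -/

/-- Projections are lax natural, because every morphism is laxly discarded. -/
lemma tensorHom_fst_le {X Y Z W : B} (R : X ⟶ Y) (S : Z ⟶ W) :
    (R ⊗ₘ S) ≫ Y ◁ ε[W] ≫ (ρ_ Y).hom ≤ (X ◁ ε[Z] ≫ (ρ_ X).hom) ≫ R := by
  calc (R ⊗ₘ S) ≫ Y ◁ ε[W] ≫ (ρ_ Y).hom = (R ⊗ₘ (S ≫ ε[W])) ≫ (ρ_ Y).hom := by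
        simp [MonoidalCategory.tensorHom_def]
    _ ≤ (R ⊗ₘ ε[Z]) ≫ (ρ_ Y).hom := comp_mono (tensor_mono le_rfl (lax_discard S)) le_rfl
    _ = _ := by simp [MonoidalCategory.tensorHom_def']

lemma tensorHom_snd_le {X Y Z W : B} (R : X ⟶ Y) (S : Z ⟶ W) :
    (R ⊗ₘ S) ≫ ε[Y] ▷ W ≫ (λ_ W).hom ≤ (ε[X] ▷ Z ≫ (λ_ Z).hom) ≫ S := by
  calc (R ⊗ₘ S) ≫ ε[Y] ▷ W ≫ (λ_ W).hom = ((R ≫ ε[Y]) ⊗ₘ S) ≫ (λ_ W).hom := by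
        simp [MonoidalCategory.tensorHom_def']
    _ ≤ (ε[X] ⊗ₘ S) ≫ (λ_ W).hom := comp_mono (tensor_mono (lax_discard R) le_rfl) le_rfl
    _ = _ := by simp [MonoidalCategory.tensorHom_def]

/-- The intersection of two morphisms: their greatest lower bound, obtained by convolution with the
comonoid on the source and the adjoint monoid on the target. -/
def inter {X Y : B} (R S : X ⟶ Y) : X ⟶ Y := Δ[X] ≫ (R ⊗ₘ S) ≫ cocopy Y

lemma inter_le_left {X Y : B} (R S : X ⟶ Y) : inter R S ≤ R := by
  have h : cocopy Y ≤ Y ◁ ε[Y] ≫ (ρ_ Y).hom := by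
    rw [← Category.comp_id (cocopy Y), (isAdj_copy Y).right_comp_le_iff,
      ComonObj.comul_counit_assoc]
    simp
  calc inter R S ≤ Δ[X] ≫ (R ⊗ₘ S) ≫ Y ◁ ε[Y] ≫ (ρ_ Y).hom :=
        comp_mono le_rfl (comp_mono le_rfl h)
    _ ≤ Δ[X] ≫ (X ◁ ε[X] ≫ (ρ_ X).hom) ≫ R := comp_mono le_rfl (tensorHom_fst_le R S)
    _ = R := by simp

lemma inter_le_right {X Y : B} (R S : X ⟶ Y) : inter R S ≤ S := by
  have h : cocopy Y ≤ ε[Y] ▷ Y ≫ (λ_ Y).hom := by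
    rw [← Category.comp_id (cocopy Y), (isAdj_copy Y).right_comp_le_iff,
      ComonObj.counit_comul_assoc]
    simp
  calc inter R S ≤ Δ[X] ≫ (R ⊗ₘ S) ≫ ε[Y] ▷ Y ≫ (λ_ Y).hom :=
        comp_mono le_rfl (comp_mono le_rfl h)
    _ ≤ Δ[X] ≫ (ε[X] ▷ X ≫ (λ_ X).hom) ≫ S := comp_mono le_rfl (tensorHom_snd_le R S)
    _ = S := by simp

lemma le_inter {X Y : B} {T R S : X ⟶ Y} (hR : T ≤ R) (hS : T ≤ S) : T ≤ inter R S := by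
  calc T ≤ (T ≫ Δ[Y]) ≫ cocopy Y := ((isAdj_copy Y).comp_left_le_iff _ _).1 le_rfl
    _ ≤ (Δ[X] ≫ (T ⊗ₘ T)) ≫ cocopy Y := comp_mono (lax_copy T) le_rfl
    _ ≤ (Δ[X] ≫ (R ⊗ₘ S)) ≫ cocopy Y :=
        comp_mono (comp_mono le_rfl (tensor_mono hR hS)) le_rfl
    _ = _ := by simp [inter]

lemma IsMap.inter_comp {X Y Z : B} {g : Y ⟶ Z} (hg : IsMap g) (S : X ⟶ Z) (R : X ⟶ Y) :
    inter (S ≫ opposite g) R ≫ g = inter S (R ≫ g) := by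
  calc inter (S ≫ opposite g) R ≫ g
      = Δ[X] ≫ (S ⊗ₘ R) ≫ opposite g ▷ Y ≫ cocopy Y ≫ g := by
        simp [inter, MonoidalCategory.tensorHom_def']
    _ = _ := by rw [← hg.whiskerLeft_cocopy]; simp [inter, MonoidalCategory.tensorHom_def]

end Calculus

section Choice

variable {B : Type u} [Category.{v} B] [MonoidalCategory B] [CartesianBicategory B]

/-! ### Tabulations and lifting of maps -/

/-- Bending the output of `R` gives a morphism to the unit, hence a map `h` to `Y ⊗ X`; its two
components tabulate `R`. -/
lemma HasEnoughMaps.exists_tabulation (hB : HasEnoughMaps B) {X Y : B} (R : X ⟶ Y) :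
    ∃ (Z : B) (f : Z ⟶ X) (g : Z ⟶ Y), IsMap f ∧ IsMap g ∧ R = opposite f ≫ g := by
  obtain ⟨Z, h, hh, e⟩ := hB (Y ◁ R ≫ cap Y)
  have hg : IsMap (h ≫ Y ◁ ε[X] ≫ (ρ_ Y).hom) :=
    hh.comp (((mapProperty B).whiskerLeft_mem Y _ (isMap_discard X)).comp (IsMap.of_iso (ρ_ _)))
  have hf : IsMap (h ≫ ε[Y] ▷ X ≫ (λ_ X).hom) :=
    hh.comp (((mapProperty B).whiskerRight_mem _ (isMap_discard Y) X).comp (IsMap.of_iso (λ_ _)))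
  have hd := eq_copy_tensor_proj hh
  set g := h ≫ Y ◁ ε[X] ≫ (ρ_ Y).hom
  set f := h ≫ ε[Y] ▷ X ≫ (λ_ X).hom
  refine ⟨Z, f, g, hf, hg, whiskerLeft_cap_injective ?_⟩
  have ho : opposite h = (opposite g ⊗ₘ opposite f) ≫ cocopy Z := by
    refine hh.isAdj.unique ?_
    rw [hd]
    exact (isAdj_copy Z).comp (hg.isAdj.tensor hf.isAdj)
  calc Y ◁ R ≫ cap Y = Y ◁ opposite f ≫ opposite g ▷ Z ≫ cap Z := by
        rw [e, ho, MonoidalCategory.tensorHom_def']; simp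
    _ = _ := by rw [opposite_cap]; simp

/-- The intersection of `Q` with the morphism `y ; gᵒᵖ` is total by Frobenius reciprocity; a map
contained in it is the required lift. -/
lemma HasChoice.exists_map_le (hC : HasChoice B) {T A Y : B} {Q : T ⟶ A} {g : A ⟶ Y}
    {y : T ⟶ Y} (hg : IsMap g) (hy : IsMap y) (h : y ≤ Q ≫ g) :
    ∃ a : T ⟶ A, IsMap a ∧ a ≤ Q ∧ a ≫ g = y := by
  obtain ⟨a, ha, hle⟩ := hC (inter (y ≫ opposite g) Q) (by
    calc ε[T] = y ≫ ε[Y] := ((isMap_iff y).1 hy).2.symm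
      _ ≤ inter y (Q ≫ g) ≫ ε[Y] := comp_mono (le_inter le_rfl h) le_rfl
      _ = inter (y ≫ opposite g) Q ≫ g ≫ ε[Y] := by rw [← hg.inter_comp, Category.assoc]
      _ = _ := by rw [((isMap_iff g).1 hg).2])
  refine ⟨a, ha, hle.trans (inter_le_right _ _), (ha.comp hg).eq_of_le hy ?_⟩
  exact (hg.isAdj.comp_left_le_iff a y).2 (hle.trans (inter_le_left _ _))

/-- The morphism `fᵒᵖ ; g` relates two maps only if they factor jointly through the span `(f, g)`. -/
lemma HasChoice.exists_lift (hC : HasChoice B) {T A X Y : B} {x : T ⟶ X} {y : T ⟶ Y}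
    {f : A ⟶ X} {g : A ⟶ Y} (hx : IsMap x) (hy : IsMap y) (hf : IsMap f) (hg : IsMap g)
    (h : y ≤ x ≫ opposite f ≫ g) : ∃ a : T ⟶ A, IsMap a ∧ a ≫ f = x ∧ a ≫ g = y := by
  obtain ⟨a, ha, hle, e⟩ := hC.exists_map_le (Q := x ≫ opposite f) hg hy (by simpa using h)
  exact ⟨a, ha, (ha.comp hf).eq_of_le hx ((hf.isAdj.comp_left_le_iff a x).2 hle), e⟩

/-- A tabulation of `f ; gᵒᵖ` is a weak pullback of `f` and `g`. -/
lemma exists_weakPullback (hB : HasEnoughMaps B) (hC : HasChoice B) {X Y Z : Maps B} (f : X ⟶ Z)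
    (g : Y ⟶ Z) : ∃ (P : Maps B) (p : P ⟶ X) (q : P ⟶ Y), p ≫ f = q ≫ g ∧
      ∀ {T : Maps B} (x : T ⟶ X) (y : T ⟶ Y), x ≫ f = y ≫ g →
        ∃ a : T ⟶ P, a ≫ p = x ∧ a ≫ q = y := by
  obtain ⟨P, p, q, hp, hq, e⟩ := hB.exists_tabulation (f.hom ≫ opposite g.hom)
  have hpq : q ≤ p ≫ f.hom ≫ opposite g.hom := by
    rw [e, ← hp.isAdj.right_comp_le_iff]
  refine ⟨⟨P⟩, ⟨p, hp⟩, ⟨q, hq⟩, WideSubcategory.hom_ext _ ?_, fun {T} x y h => ?_⟩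
  · refine ((hq.comp g.property).eq_of_le (hp.comp f.property) ?_).symm
    rw [g.property.isAdj.comp_left_le_iff]
    simpa using hpq
  · have h' : x.hom ≫ f.hom = y.hom ≫ g.hom := congrArg InducedWideCategory.Hom.hom h
    obtain ⟨a, ha, e₁, e₂⟩ := hC.exists_lift x.property y.property hp hq (by
      rw [← e, ← Category.assoc, ← g.property.isAdj.comp_left_le_iff, h'])
    exact ⟨⟨a, ha⟩, WideSubcategory.hom_ext _ e₁, WideSubcategory.hom_ext _ e₂⟩

lemma hasWeakPullbacks_maps (hB : HasEnoughMaps B) (hC : HasChoice B) :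
    HasWeakPullbacks (Maps B) where
  hasWeakLimit F := by
    obtain ⟨P, p, q, e, h⟩ := exists_weakPullback hB hC
      (F.map WalkingCospan.Hom.inl) (F.map WalkingCospan.Hom.inr)
    choose l hl₁ hl₂ using fun s : PullbackCone (F.map WalkingCospan.Hom.inl)
      (F.map WalkingCospan.Hom.inr) => h s.fst s.snd s.condition
    have : HasWeakLimit (cospan (F.map WalkingCospan.Hom.inl) (F.map WalkingCospan.Hom.inr)) :=
      HasWeakLimit.mk ⟨PullbackCone.mk p q e, PullbackCone.IsWeakLimit.mk e l hl₁ hl₂⟩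
    exact hasWeakLimit_of_iso (diagramIsoCospan F).symm

/-! ### Morphisms as spans of maps -/

/-- The diagonal of `X` in `Map(B)` is the comultiplication of `X`. -/
lemma lift_id_id_hom (X : Maps B) : (lift (𝟙 X) (𝟙 X)).hom = Δ[X.obj] := by
  have : lift (𝟙 X) (𝟙 X) = ⟨Δ[X.obj], isMap_copy X.obj⟩ := by
    refine CartesianMonoidalCategory.hom_ext _ _ ?_ ?_
    · rw [lift_fst]
      exact WideSubcategory.hom_ext _
        ((ComonObj.comul_counit_assoc X.obj (ρ_ X.obj).hom).trans (by simp)).symm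
    · rw [lift_snd]
      exact WideSubcategory.hom_ext _
        ((ComonObj.counit_comul_assoc X.obj (λ_ X.obj).hom).trans (by simp)).symm
  rw [this]

lemma toUnit_hom (X : Maps B) : (toUnit X).hom = ε[X.obj] :=
  congrArg InducedWideCategory.Hom.hom
    (toUnit_unique (toUnit X) (⟨ε[X.obj], isMap_discard X.obj⟩ : X ⟶ 𝟙_ (Maps B)))

lemma exists_spanClass (hB : HasEnoughMaps B) (hC : HasChoice B) {X Y : Maps B}
    (R : X.obj ⟶ Y.obj) : ∃ S : SpanClass X Y, ∀ {T : Maps B} (x : T ⟶ X) (y : T ⟶ Y),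
      S.Rel x y ↔ y.hom ≤ x.hom ≫ R := by
  obtain ⟨A, f, g, hf, hg, rfl⟩ := hB.exists_tabulation R
  refine ⟨.mk (.of (A := ⟨A⟩) ⟨f, hf⟩ ⟨g, hg⟩), fun {T} x y => (Spans.rel_of _ _ _ _).trans ?_⟩
  constructor
  · rintro ⟨a, rfl, rfl⟩
    have := (hf.isAdj.comp_left_le_iff a.hom (a.hom ≫ f)).1 le_rfl
    simpa using comp_mono this (le_refl g)
  · intro h
    obtain ⟨a, ha, e₁, e₂⟩ := hC.exists_lift x.property y.property hf hg h
    exact ⟨⟨a, ha⟩, WideSubcategory.hom_ext _ e₁, WideSubcategory.hom_ext _ e₂⟩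

/-- The class of spans of maps representing a morphism `R` of `B`: it relates the generalised
elements `x` and `y` if and only if `y ≤ x ; R`. -/
noncomputable def toSpan (hB : HasEnoughMaps B) (hC : HasChoice B) {X Y : Maps B}
    (R : X.obj ⟶ Y.obj) : SpanClass X Y :=
  (exists_spanClass hB hC R).choose

variable (hB : HasEnoughMaps B) (hC : HasChoice B)

lemma rel_toSpan {X Y T : Maps B} (R : X.obj ⟶ Y.obj) (x : T ⟶ X) (y : T ⟶ Y) :
    (toSpan hB hC R).Rel x y ↔ y.hom ≤ x.hom ≫ R :=
  (exists_spanClass hB hC R).choose_spec x y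

lemma toSpan_le_iff {X Y : Maps B} (R S : X.obj ⟶ Y.obj) :
    toSpan hB hC R ≤ toSpan hB hC S ↔ R ≤ S := by
  simp only [SpanClass.le_iff, rel_toSpan]
  constructor
  · intro h
    obtain ⟨A, f, g, hf, hg, rfl⟩ := hB.exists_tabulation R
    rw [hf.isAdj.right_comp_le_iff]
    exact h (A := ⟨A⟩) ⟨f, hf⟩ ⟨g, hg⟩ (by rw [← hf.isAdj.right_comp_le_iff])
  · exact fun h A x y k => k.trans (comp_mono le_rfl h)

/-- The class of a span `(l, r)` represents `lᵒᵖ ; r`. -/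
lemma toSpan_surjective {X Y : Maps B} (S : SpanClass X Y) :
    ∃ R : X.obj ⟶ Y.obj, toSpan hB hC R = S := by
  induction S using Quotient.ind with | _ S
  refine ⟨opposite S.l.hom ≫ S.r.hom, SpanClass.ext_rel fun {T} x y => ?_⟩
  rw [rel_toSpan]
  constructor
  · intro h
    obtain ⟨a, ha, e₁, e₂⟩ :=
      hC.exists_lift x.property y.property S.l.property S.r.property h
    exact ⟨⟨a, ha⟩, WideSubcategory.hom_ext _ e₁, WideSubcategory.hom_ext _ e₂⟩
  · rintro ⟨a, rfl, rfl⟩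
    have := (S.l.property.isAdj.comp_left_le_iff a.hom (a.hom ≫ S.l.hom)).1 le_rfl
    simpa using comp_mono this (le_refl S.r.hom)

/-- The bijection between the morphisms of `B` and the classes of spans of maps, given by
`toSpan`. -/
noncomputable def spanEquiv (X Y : Maps B) : (X.obj ⟶ Y.obj) ≃ SpanClass X Y :=
  Equiv.ofBijective (toSpan hB hC)
    ⟨fun R S h => le_antisymm ((toSpan_le_iff hB hC R S).1 h.le) ((toSpan_le_iff hB hC S R).1 h.ge),
      toSpan_surjective hB hC⟩

lemma toSpan_symm {X Y : Maps B} (S : SpanClass X Y) :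
    toSpan hB hC ((spanEquiv hB hC X Y).symm S) = S :=
  (spanEquiv hB hC X Y).apply_symm_apply S

lemma toSpan_map {X Y : Maps B} (f : X ⟶ Y) : toSpan hB hC f.hom = SpanTilde.graph f :=
  SpanClass.ext_rel fun x y => by
    rw [rel_toSpan, SpanTilde.rel_graph]
    constructor
    · intro h
      exact WideSubcategory.hom_ext _ (y.property.eq_of_le (x.property.comp f.property) h).symm
    · rintro rfl
      exact le_rfl

lemma toSpan_adjoint {X Y : Maps B} (f : X ⟶ Y) {g : Y.obj ⟶ X.obj} (h : IsAdj f.hom g) :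
    toSpan hB hC g = SpanTilde.cograph f :=
  SpanClass.ext_rel fun x y => by
    rw [rel_toSpan, SpanTilde.rel_cograph, ← h.comp_left_le_iff]
    constructor
    · intro h
      exact WideSubcategory.hom_ext _ ((y.property.comp f.property).eq_of_le x.property h)
    · rintro rfl
      exact le_rfl

/-- The middle element relating `x` and `z` through `R` and `S` is found by lifting `z` along a
tabulation of `S`. -/
lemma toSpan_comp [HasWeakPullbacks (Maps B)] {X Y Z : Maps B} (R : X.obj ⟶ Y.obj)
    (S : Y.obj ⟶ Z.obj) :
    toSpan hB hC (R ≫ S) = (toSpan hB hC R).comp (toSpan hB hC S) :=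
  SpanClass.ext_rel fun {T} x z => by
    simp only [SpanClass.rel_comp, rel_toSpan]
    constructor
    · intro h
      obtain ⟨A, f, g, hf, hg, rfl⟩ := hB.exists_tabulation S
      obtain ⟨a, ha, hle, e⟩ := hC.exists_map_le (Q := x.hom ≫ R ≫ opposite f) hg z.property
        (by simpa using h)
      refine ⟨⟨a ≫ f, ha.comp hf⟩, ?_, ?_⟩
      · rw [hf.isAdj.comp_left_le_iff]
        simpa using hle
      · have := (hf.isAdj.comp_left_le_iff a (a ≫ f)).1 le_rfl
        rw [← e]
        simpa using comp_mono this (le_refl g)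
    · rintro ⟨y, h₁, h₂⟩
      refine h₂.trans ?_
      simpa using comp_mono h₁ (le_refl S)

lemma toSpan_tensor {X Y Z W : Maps B} (R : X.obj ⟶ Y.obj) (S : Z.obj ⟶ W.obj) :
    toSpan hB hC (X := X ⊗ Z) (Y := Y ⊗ W) (R ⊗ₘ S) =
      (toSpan hB hC R).tensor (toSpan hB hC S) :=
  SpanClass.ext_rel fun {T} x y => by
    simp only [SpanClass.rel_tensor, rel_toSpan]
    have hx : x.hom = Δ[T.obj] ≫ ((x ≫ fst X Z).hom ⊗ₘ (x ≫ snd X Z).hom) :=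
      eq_copy_tensor_proj x.property
    have hy : y.hom = Δ[T.obj] ≫ ((y ≫ fst Y W).hom ⊗ₘ (y ≫ snd Y W).hom) :=
      eq_copy_tensor_proj y.property
    constructor
    · intro h
      have h₁ := (comp_mono h (le_refl (Y.obj ◁ ε[W.obj] ≫ (ρ_ Y.obj).hom))).trans
        ((Category.assoc _ _ _).trans_le (comp_mono le_rfl (tensorHom_fst_le R S)))
      have h₂ := (comp_mono h (le_refl (ε[Y.obj] ▷ W.obj ≫ (λ_ W.obj).hom))).trans
        ((Category.assoc _ _ _).trans_le (comp_mono le_rfl (tensorHom_snd_le R S)))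
      exact ⟨h₁.trans_eq (Category.assoc _ _ _).symm, h₂.trans_eq (Category.assoc _ _ _).symm⟩
    · rintro ⟨h₁, h₂⟩
      rw [hx, hy]
      refine (comp_mono le_rfl (tensor_mono h₁ h₂)).trans ?_
      simp

end Choice

section Transfer

/-! ### The axiom of choice along an isomorphism -/

/-- A span `X ← A → Y` is total when its left leg has a section `s`, and the composite of `s` with the
right leg is then a map below it. -/
lemma hasChoice_spanTilde {C : Type u} [Category.{v} C] [CartesianMonoidalCategory C]
    [BraidedCategory C] [HasWeakPullbacks C] : HasChoice (SpanTilde C) := fun X Y R hR => by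
  obtain ⟨y, hy, -⟩ := (SpanClass.rel_comp _ _ _ _).1 <|
    SpanClass.le_iff.1 hR (𝟙 X.obj) (toUnit X.obj) ((SpanTilde.rel_graph _ _ _).2 (by simp))
  refine ⟨SpanTilde.graph y, IsMap.of_adjoint _ (SpanTilde.cograph y) ?_ ?_,
    SpanClass.le_iff.2 fun x z h => ?_⟩
  · refine SpanClass.le_iff.2 fun x z h => ?_
    obtain rfl := (SpanTilde.rel_graph _ _ _).1 h
    exact (SpanTilde.graph_comp_rel _ _ _ _).2 ((SpanTilde.rel_cograph _ _ _).2 (by simp))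
  · refine SpanClass.le_iff.2 fun x z h => ?_
    obtain ⟨w, a, b⟩ := (SpanClass.rel_comp _ _ _ _).1 h
    exact (SpanTilde.rel_graph _ _ _).2 ((Category.comp_id _).trans
      (((SpanTilde.rel_cograph _ _ _).1 a).symm.trans ((SpanTilde.rel_graph _ _ _).1 b)))
  · obtain rfl := (SpanTilde.rel_graph _ _ _).1 h
    simpa using SpanClass.rel_precomp R x hy

variable {B : Type u₁} [Category.{v₁} B] [MonoidalCategory B] [CartesianBicategory B]
  {B' : Type u₂} [Category.{v₂} B'] [MonoidalCategory B'] [CartesianBicategory B']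

lemma Morphism.map_isMap (F : Morphism B B') {X Y : B} {f : X ⟶ Y} (hf : IsMap f) :
    IsMap (F.map f) :=
  IsMap.of_adjoint _ (F.map (opposite f))
    (by rw [← F.map_comp, ← F.map_id]; exact F.map_mono hf.isAdj.unit)
    (by rw [← F.map_comp, ← F.map_id]; exact F.map_mono hf.isAdj.counit)

lemma Morphism.map_isTotal (F : Morphism B B') {X Y : B} {R : X ⟶ Y} (hR : IsTotal R) :
    IsTotal (F.map R) := by
  let := F.braided
  have hd (Z : B) : F.map ε[Z] ≫ Functor.OplaxMonoidal.η F.toFunctor = ε[F.obj Z] := by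
    rw [F.map_discard, Category.assoc]
    exact (congrArg (ε[F.obj Z] ≫ ·) (Functor.Monoidal.ε_η F.toFunctor)).trans (Category.comp_id _)
  have h := comp_mono (F.map_mono hR) (le_refl (Functor.OplaxMonoidal.η F.toFunctor))
  rwa [F.map_comp, Category.assoc, hd, hd] at h

/-- A total `R` contains the preimage of a map contained in the image of `R`. -/
lemma Isomorphism.hasChoice (e : Isomorphism B B') (h : HasChoice B') : HasChoice B := by
  intro X Y R hR
  obtain ⟨f, hf, hle⟩ := h _ (e.hom.map_isTotal hR)
  -- `i` identifies an object with its image under the round trip through `B'`.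
  let i := eqToIso e.hom_inv_id
  refine ⟨i.inv.app X ≫ e.inv.map f ≫ i.hom.app Y, (IsMap.of_iso (i.app X).symm).comp
    ((e.inv.map_isMap hf).comp (IsMap.of_iso (i.app Y))), ?_⟩
  calc i.inv.app X ≫ e.inv.map f ≫ i.hom.app Y
      ≤ i.inv.app X ≫ e.inv.map (e.hom.map R) ≫ i.hom.app Y :=
        comp_mono le_rfl (comp_mono (e.inv.map_mono hle) le_rfl)
    _ = R := by
        have := i.hom.naturality R
        simp only [Functor.comp_map] at this
        rw [this, ← Category.assoc, ← NatTrans.comp_app, i.inv_hom_id]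
        simp

end Transfer

section Strict

/-! ### The isomorphism with spans of maps -/

/-- The next lemmas are the laws of a monoidal functor whose coherence morphisms are identities. They
are applied to functors that commute with `⊗` and `𝟙_` on objects only after unfolding, so that `simp`
cannot be used on the original goals. -/
lemma strict_natural {C : Type u} [Category.{v} C] {X Y : C} {f g : X ⟶ Y}
    (h : g = f) : f ≫ 𝟙 Y = 𝟙 X ≫ g := by simp [h]

variable {C : Type u} [Category.{v} C] [MonoidalCategory C]

lemma strict_associativity {X Y Z : C} {f : (X ⊗ Y) ⊗ Z ⟶ X ⊗ Y ⊗ Z} (h : f = (α_ X Y Z).hom) :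
    𝟙 (X ⊗ Y) ▷ Z ≫ 𝟙 _ ≫ f = (α_ X Y Z).hom ≫ X ◁ 𝟙 (Y ⊗ Z) ≫ 𝟙 _ := by simp [h]

lemma strict_left_unitality {X : C} {f : 𝟙_ C ⊗ X ⟶ X} (h : f = (λ_ X).hom) :
    (λ_ X).hom = 𝟙 (𝟙_ C) ▷ X ≫ 𝟙 _ ≫ f := by simp [h]

lemma strict_right_unitality {X : C} {f : X ⊗ 𝟙_ C ⟶ X} (h : f = (ρ_ X).hom) :
    (ρ_ X).hom = X ◁ 𝟙 (𝟙_ C) ≫ 𝟙 _ ≫ f := by simp [h]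

lemma strict_braided [BraidedCategory C] {X Y : C} {f : X ⊗ Y ⟶ Y ⊗ X} (h : f = (β_ X Y).hom) :
    𝟙 (X ⊗ Y) ≫ f = (β_ X Y).hom ≫ 𝟙 (Y ⊗ X) := by simp [h]

end Strict

section Iso

variable {B : Type u} [Category.{v} B] [MonoidalCategory B] [CartesianBicategory B]
variable [HasWeakPullbacks (Maps B)] (hB : HasEnoughMaps B) (hC : HasChoice B)

/-- The functor `B ⥤ Span∼(Map(B))` sending a morphism to the class of spans representing it. -/
noncomputable def spanFunctor : B ⥤ SpanTilde (Maps B) where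
  obj X := ⟨⟨X⟩⟩
  map R := toSpan hB hC (X := ⟨_⟩) (Y := ⟨_⟩) R
  map_id X := toSpan_map hB hC (𝟙 (⟨X⟩ : Maps B))
  map_comp R S := toSpan_comp hB hC (X := ⟨_⟩) (Y := ⟨_⟩) (Z := ⟨_⟩) R S

/-- The inverse of `spanFunctor`; it sends the class of a span `(f, g)` to `fᵒᵖ ; g`. -/
noncomputable def relFunctor : SpanTilde (Maps B) ⥤ B where
  obj X := X.obj.obj
  map {X Y} S := (spanEquiv hB hC X.obj Y.obj).symm S
  map_id X := (Equiv.symm_apply_eq _).2 (toSpan_map hB hC (𝟙 X.obj)).symm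
  map_comp {X Y Z} S T := (Equiv.symm_apply_eq _).2 (by
    refine .trans ?_ (toSpan_comp hB hC _ _).symm
    exact congrArg₂ SpanClass.comp ((spanEquiv hB hC X.obj Y.obj).apply_symm_apply S).symm
      ((spanEquiv hB hC Y.obj Z.obj).apply_symm_apply T).symm)

lemma spanFunctor_map_map {X Y : Maps B} (f : X ⟶ Y) :
    (spanFunctor hB hC).map f.hom = SpanTilde.graph f :=
  toSpan_map hB hC f

lemma relFunctor_map_graph {X Y : SpanTilde (Maps B)} (f : X.obj ⟶ Y.obj) :
    (relFunctor hB hC).map (X := X) (Y := Y) (SpanTilde.graph f) = f.hom :=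
  (Equiv.symm_apply_eq _).2 (toSpan_map hB hC f).symm

lemma spanFunctor_map_tensor {X Y Z W : B} (R : X ⟶ Y) (S : Z ⟶ W) :
    (spanFunctor hB hC).map (R ⊗ₘ S) =
      ((spanFunctor hB hC).map R ⊗ₘ (spanFunctor hB hC).map S) :=
  toSpan_tensor hB hC (X := ⟨X⟩) (Y := ⟨Y⟩) (Z := ⟨Z⟩) (W := ⟨W⟩) R S

lemma relFunctor_map_tensor {X Y Z W : SpanTilde (Maps B)} (S : X ⟶ Y) (T : Z ⟶ W) :
    (relFunctor hB hC).map (S ⊗ₘ T) =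
      ((relFunctor hB hC).map S ⊗ₘ (relFunctor hB hC).map T) :=
  (Equiv.symm_apply_eq _).2 (by
    refine .trans ?_ (toSpan_tensor hB hC _ _).symm
    exact congrArg₂ SpanClass.tensor (toSpan_symm hB hC S).symm (toSpan_symm hB hC T).symm)

/-- `spanFunctor` is strict monoidal. -/
noncomputable def spanFunctorCoreMonoidal : (spanFunctor hB hC).CoreMonoidal where
  εIso := Iso.refl _
  μIso _ _ := Iso.refl _
  μIso_hom_natural_left {X Y} R Z := strict_natural <| by
    rw [← MonoidalCategory.tensorHom_id, ← MonoidalCategory.tensorHom_id,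
      ← (spanFunctor hB hC).map_id]
    exact spanFunctor_map_tensor hB hC R (𝟙 Z)
  μIso_hom_natural_right {X Y} Z R := strict_natural <| by
    rw [← MonoidalCategory.id_tensorHom, ← MonoidalCategory.id_tensorHom,
      ← (spanFunctor hB hC).map_id]
    exact spanFunctor_map_tensor hB hC (𝟙 Z) R
  associativity X Y Z := strict_associativity
    (spanFunctor_map_map hB hC (α_ (⟨X⟩ : Maps B) ⟨Y⟩ ⟨Z⟩).hom)
  left_unitality X := strict_left_unitality (spanFunctor_map_map hB hC (λ_ (⟨X⟩ : Maps B)).hom)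
  right_unitality X := strict_right_unitality (spanFunctor_map_map hB hC (ρ_ (⟨X⟩ : Maps B)).hom)

noncomputable instance spanFunctorBraided : (spanFunctor hB hC).Braided where
  __ := (spanFunctorCoreMonoidal hB hC).toMonoidal
  braided X Y := strict_braided
    (spanFunctor_map_map hB hC (β_ (⟨X⟩ : Maps B) ⟨Y⟩).hom)

/-- `relFunctor` is strict monoidal. -/
noncomputable def relFunctorCoreMonoidal : (relFunctor hB hC).CoreMonoidal where
  εIso := Iso.refl _
  μIso _ _ := Iso.refl _
  μIso_hom_natural_left {X Y} R Z := strict_natural <| by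
    rw [← MonoidalCategory.tensorHom_id, ← MonoidalCategory.tensorHom_id,
      ← (relFunctor hB hC).map_id]
    exact relFunctor_map_tensor hB hC R (𝟙 Z)
  μIso_hom_natural_right {X Y} Z R := strict_natural <| by
    rw [← MonoidalCategory.id_tensorHom, ← MonoidalCategory.id_tensorHom,
      ← (relFunctor hB hC).map_id]
    exact relFunctor_map_tensor hB hC (𝟙 Z) R
  associativity X Y Z := strict_associativity
    (relFunctor_map_graph hB hC (α_ X.obj Y.obj Z.obj).hom)
  left_unitality X := strict_left_unitality (relFunctor_map_graph hB hC (λ_ X.obj).hom)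
  right_unitality X := strict_right_unitality (relFunctor_map_graph hB hC (ρ_ X.obj).hom)

noncomputable instance relFunctorBraided : (relFunctor hB hC).Braided where
  __ := (relFunctorCoreMonoidal hB hC).toMonoidal
  braided X Y := strict_braided (relFunctor_map_graph hB hC (β_ X.obj Y.obj).hom)

lemma spanFunctor_map_copy (X : B) :
    (spanFunctor hB hC).map Δ[X] = Δ[(spanFunctor hB hC).obj X] := by
  rw [← lift_id_id_hom ⟨X⟩]
  exact toSpan_map hB hC _

lemma spanFunctor_map_discard (X : B) :
    (spanFunctor hB hC).map ε[X] = ε[(spanFunctor hB hC).obj X] := by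
  rw [← toUnit_hom ⟨X⟩]
  exact toSpan_map hB hC _

lemma spanFunctor_map_cocopy (X : B) :
    (spanFunctor hB hC).map (cocopy X) = cocopy ((spanFunctor hB hC).obj X) :=
  toSpan_adjoint hB hC (X := ⟨X⟩) (lift (𝟙 _) (𝟙 _))
    (by rw [lift_id_id_hom]; exact isAdj_copy X)

lemma spanFunctor_map_codiscard (X : B) :
    (spanFunctor hB hC).map (codiscard X) = codiscard ((spanFunctor hB hC).obj X) :=
  toSpan_adjoint hB hC (X := ⟨X⟩) (toUnit _) (by rw [toUnit_hom]; exact isAdj_discard X)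

/-- `spanFunctor` as a morphism of cartesian bicategories. -/
noncomputable def spanMorphism : Morphism B (SpanTilde (Maps B)) where
  toFunctor := spanFunctor hB hC
  map_mono h := (toSpan_le_iff hB hC _ _).2 h
  map_copy X := (spanFunctor_map_copy hB hC X).trans (Category.comp_id _).symm
  map_discard X := (spanFunctor_map_discard hB hC X).trans (Category.comp_id _).symm
  map_cocopy X := (Category.id_comp _).trans (spanFunctor_map_cocopy hB hC X)
  map_codiscard X := (Category.id_comp _).trans (spanFunctor_map_codiscard hB hC X)

/-- `relFunctor` as a morphism of cartesian bicategories. -/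
noncomputable def relMorphism : Morphism (SpanTilde (Maps B)) B where
  toFunctor := relFunctor hB hC
  map_mono {_ _ R S} h := (toSpan_le_iff hB hC _ _).1 <|
    (toSpan_symm hB hC R).trans_le (h.trans_eq (toSpan_symm hB hC S).symm)
  map_copy X := ((Equiv.symm_apply_eq _).2 (spanFunctor_map_copy hB hC X.obj.obj).symm).trans
    (Category.comp_id _).symm
  map_discard X := ((Equiv.symm_apply_eq _).2 (spanFunctor_map_discard hB hC X.obj.obj).symm).trans
    (Category.comp_id _).symm
  map_cocopy X := (Category.id_comp _).trans
    ((Equiv.symm_apply_eq _).2 (spanFunctor_map_cocopy hB hC X.obj.obj).symm)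
  map_codiscard X := (Category.id_comp _).trans
    ((Equiv.symm_apply_eq _).2 (spanFunctor_map_codiscard hB hC X.obj.obj).symm)

/-- With enough maps and choice, `B` is isomorphic to `Span∼(Map(B))`. -/
noncomputable def spanIsomorphism : Isomorphism B (SpanTilde (Maps B)) where
  hom := spanMorphism hB hC
  inv := relMorphism hB hC
  hom_inv_id := CategoryTheory.Functor.ext (fun _ => rfl) fun X Y R => 
    ((spanEquiv hB hC ⟨X⟩ ⟨Y⟩).symm_apply_apply R).trans
      ((Category.id_comp _).trans (Category.comp_id _)).symm
  inv_hom_id := CategoryTheory.Functor.ext (fun _ => rfl) fun X Y S => 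
    ((spanEquiv hB hC X.obj Y.obj).apply_symm_apply S).trans
      ((Category.id_comp _).trans (Category.comp_id _)).symm

end Iso
end CartBicat

theorem mainTheorem1 {B : Type u} [Category.{v} B] [MonoidalCategory B]
    [CartBicat.CartesianBicategory B] (hB : CartBicat.HasEnoughMaps B) :
    CartBicat.HasChoice B ↔
      ∃ _ : Limits.HasWeakPullbacks (CartBicat.Maps B),
        Nonempty (CartBicat.Isomorphism B (CartBicat.SpanTilde (CartBicat.Maps B))) := by
  constructor
  · intro hC
    exact ⟨CartBicat.hasWeakPullbacks_maps hB hC,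
      ⟨@CartBicat.spanIsomorphism _ _ _ _ (CartBicat.hasWeakPullbacks_maps hB hC) hB hC⟩⟩
  · rintro ⟨_, ⟨e⟩⟩
    exact e.hasChoice CartBicat.hasChoice_spanTilde
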